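/- Let $\lambda_1,\lambda_2,\mu_1,\mu_2>0$, $\eta_1>0$, $\eta_2=0$, $p\in[0,1]$ and $j\in\mathbb N_0$. Let ${\bf N}(t)=[N(t),\mathscr E(t)]$, $t\ge 0$, be a continuous-time Markov chain on $\mathbb N_0\times\{1,2\}$ whose transitions are $(n,i)\to(n+1,i)$ with rate $\lambda_i$, $(n,i)\to(n-1,i)$ with rate $\mu_i$ if $n\ge 1$, and $(n,1)\to(n,2)$ with rate $\eta_1$ (an $M/M/1$ queue in two environments, where only the switch from environment 1 to environment 2 is allowed), and whose initial state is $(j,1)$ with probability $p$ and $(j,2)$ with probability $1-p$. Put $p_{n,i}(t)=\mathbb P[{\bf N}(t)=(n,i)]$. For $i=1,2$, $k,n\in\mathbb N_0$ and $t\ge 0$ let $$ \widehat p_{k,n}^{(i)}(t)=e^{-(\lambda_i+\mu_i)t}\Big\{\Big(\frac{\lambda_i}{\mu_i}\Big)^{(n-k)/2}I_{n-k}(2t\sqrt{\lambda_i\mu_i})+\Big(\frac{\lambda_i}{\mu_i}\Big)^{(n-k-1)/2}I_{n+k+1}(2t\sqrt{\lambda_i\mu_i})+\Big(1-\frac{\lambda_i}{\mu_i}\Big)\Big(\frac{\lambda_i}{\mu_i}\Big)^{n}\sum_{r=n+k+2}^{\infty}\Big(\frac{\mu_i}{\lambda_i}\Big)^{r/2}I_r(2t\sqrt{\lambda_i\mu_i})\Big\},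 $$ where $I_\nu$ is the modified Bessel function of the first kind. Then the following holds. 1. For all $t\ge 0$ and $n\in\mathbb N_0$, $$p_{n,1}(t)=p\,e^{-\eta_1 t}\,\widehat p_{j,n}^{(1)}(t),$$ $$p_{n,2}(t)=(1-p)\,\widehat p_{j,n}^{(2)}(t)+p\,\eta_1\sum_{k=0}^{\infty}\int_0^t e^{-\eta_1\tau}\,\widehat p_{j,k}^{(1)}(\tau)\,\widehat p_{k,n}^{(2)}(t-\tau)\,d\tau .$$ 2. $\widehat p_{k,n}^{(i)}(t)$ is the transient probability of the $M/M/1$ queue with arrival rate $\lambda_i$ and service rate $\mu_i$: every transition function of that queue (every stochastic transition function on $\mathbb N_0$ with its transition rates) has the value $\widehat p_{k,n}^{(i)}(t)$ at time $t$ from $k$ to $n$. 3. For $i=1,2$, $n\in\mathbb N_0$ and $t>0$, $$\widehat p_{0,n}^{(i)}(t)=\frac1{\mu_i}\Big(\frac{\lambda_i}{\mu_i}\Big)^n\frac1t\,e^{-(\lambda_i+\mu_i)t}\sum_{k=n+1}^{\infty}k\Big(\frac{\mu_i}{\lambda_i}\Big)^{k/2}I_k(2t\sqrt{\lambda_i\mu_i}).$$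 All the series and integrals above converge. -/

import Mathlib

open Filter Topology MeasureTheory
open scoped NNReal Nat

noncomputable section

/-! ### Continuous-time Markov chains on a countable state space -/

/-- The Q-matrix with off-diagonal entries `r x y` (the rate of the jump from `x` to `y`) and
zero row sums. -/
def qMatrix {S : Type*} [DecidableEq S] (r : S → S → ℝ) (x y : S) : ℝ :=
  if x = y then -∑' z : {z : S // z ≠ x}, r x z else r x y

/-- `P t x y`, `t ≥ 0`, is an honest (stochastic) transition function on `S`. -/
structure IsTransitionFunction {S : Type*} [DecidableEq S] (P : ℝ≥0 → S → S → ℝ) : Prop where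
  nonneg : ∀ t x y, 0 ≤ P t x y
  hasSum_one : ∀ t x, HasSum (fun y => P t x y) 1
  zero : ∀ x y, P 0 x y = if x = y then 1 else 0
  chapman_kolmogorov : ∀ s t x y, HasSum (fun z => P s x z * P t z y) (P (s + t) x y)

/-- The transition function `P` has Q-matrix `Q`: every entry has (right) derivative `Q x y` at
time zero, that is `P h x y = δ_{x,y} + Q x y * h + o(h)` as `h ↓ 0`. -/
def HasQMatrix {S : Type*} [DecidableEq S] (P : ℝ≥0 → S → S → ℝ) (Q : S → S → ℝ) : Prop :=
  ∀ x y, Tendsto (fun h : ℝ≥0 => (P h x y - if x = y then 1 else 0) / (h : ℝ)) (𝓝[>] 0)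
    (𝓝 (Q x y))

/-- The events that are determined by the process `X` up to time `s`. -/
abbrev pastEvents {S Ω : Type*} (X : ℝ≥0 → Ω → S) (s : ℝ≥0) : MeasurableSpace Ω :=
  ⨆ u : {u : ℝ≥0 // u ≤ s}, MeasurableSpace.comap (X u) ⊤

/-- On the probability space `(Ω, ℙ)`, the process `X` is a time-homogeneous Markov chain in
continuous time, with values in `S` and with transition function `P`:
`ℙ (X (s + h) = y | A, X s = x) = P h x y` for every event `A` of the past of `s`. -/
structure IsMarkovChainWith {S Ω : Type*} [DecidableEq S] [MeasurableSpace Ω] (ℙ : Measure Ω)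
    (X : ℝ≥0 → Ω → S) (P : ℝ≥0 → S → S → ℝ) : Prop where
  measurableSet : ∀ t x, MeasurableSet {ω | X t ω = x}
  transition : IsTransitionFunction P
  markov : ∀ (s h : ℝ≥0) (x y : S) (A : Set Ω), MeasurableSet[pastEvents X s] A →
    ℙ.real (A ∩ {ω | X s ω = x} ∩ {ω | X (s + h) ω = y}) =
      ℙ.real (A ∩ {ω | X s ω = x}) * P h x y

/-- `X` is a continuous-time Markov chain with jump rates `r`. -/
def IsMarkovChain {S Ω : Type*} [DecidableEq S] [MeasurableSpace Ω] (ℙ : Measure Ω)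
    (X : ℝ≥0 → Ω → S) (r : S → S → ℝ) : Prop :=
  ∃ P : ℝ≥0 → S → S → ℝ, IsMarkovChainWith ℙ X P ∧ HasQMatrix P (qMatrix r)

/-! ### The two queues -/

/-- Jump rates of the `M/M/1` queue with arrival rate `lam` and service rate `mu`. -/
def mm1Rate (lam mu : ℝ) (n m : ℕ) : ℝ :=
  if m = n + 1 then lam else if m + 1 = n then mu else 0

/-- The two operating environments. -/
inductive Env where
  | one
  | two
  deriving DecidableEq

/-- Jump rates of the `M/M/1` queue in a switching environment, with state `(n, i)`: `n` customers
and environment `i`. In environment `i` customers arrive at rate `lam i` and are served at rate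
`mu i`, and the environment changes at rate `eta i`. -/
def switchingRate (lam mu eta : Env → ℝ) (x y : ℕ × Env) : ℝ :=
  if y.2 = x.2 then mm1Rate (lam x.2) (mu x.2) x.1 y.1
  else if y.1 = x.1 then eta x.2 else 0

/-! ### Bessel functions and the transient probabilities of the `M/M/1` queue -/

/-- The modified Bessel function of the first kind `I_ν`, of integer order `ν`. For negative `ν`
the terms with `m + ν + 1 ≤ 0` vanish, since `Real.Gamma` is `0` at the poles of `Γ` and so is the
quotient, as it should be for the entire function `1 / Γ`. -/
def besselI (ν : ℤ) (z : ℝ) : ℝ :=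
  ∑' m : ℕ, (z / 2) ^ (2 * (m : ℤ) + ν) / ((m ! : ℝ) * Real.Gamma ((m : ℝ) + ν + 1))

/-- The series that defines `besselI` converges. -/
theorem summable_besselI (ν : ℤ) (z : ℝ) :
    Summable fun m : ℕ =>
      (z / 2) ^ (2 * (m : ℤ) + ν) / ((m ! : ℝ) * Real.Gamma ((m : ℝ) + ν + 1)) := by
  obtain ⟨c, hc⟩ : ∃ c : ℕ, 0 ≤ (c : ℤ) + ν := ⟨ν.natAbs, by omega⟩
  obtain ⟨a, ha⟩ : ∃ a : ℕ, (a : ℤ) = c + ν := ⟨(c + ν).toNat, by omega⟩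
  obtain ⟨b, hb⟩ : ∃ b : ℕ, (b : ℤ) = 2 * c + ν := ⟨(2 * c + ν).toNat, by omega⟩
  rw [← summable_nat_add_iff c]
  have hs := (Real.summable_pow_div_factorial ((|z| / 2) ^ 2)).mul_left ((|z| / 2) ^ b)
  refine Summable.of_norm_bounded hs fun m => ?_
  have h1 : ((m + c : ℕ) : ℝ) + ν + 1 = ((m + a : ℕ) : ℝ) + 1 := by
    have : ((a : ℤ) : ℝ) = ((c + ν : ℤ) : ℝ) := by rw [ha]
    push_cast at this ⊢
    linarith
  have h2 : 2 * ((m + c : ℕ) : ℤ) + ν = ((b + 2 * m : ℕ) : ℤ) := by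
    push_cast
    omega
  have h3 : (m ! : ℝ) ≤ ((m + c) ! : ℝ) := by
    exact_mod_cast Nat.factorial_le (by omega)
  have h4 : (1 : ℝ) ≤ ((m + a) ! : ℝ) := by
    exact_mod_cast Nat.one_le_iff_ne_zero.mpr (Nat.factorial_ne_zero _)
  have h5 : (0 : ℝ) < (m ! : ℝ) := by positivity
  rw [h1, h2, Real.Gamma_nat_eq_factorial, zpow_natCast, norm_div, norm_pow, norm_div,
    Real.norm_eq_abs z, Real.norm_two, pow_add, pow_mul, mul_div_assoc,
    Real.norm_of_nonneg (by positivity : (0 : ℝ) ≤ ((m + c) ! : ℝ) * ((m + a) ! : ℝ))]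
  have h6 : (m ! : ℝ) ≤ ((m + c) ! : ℝ) * ((m + a) ! : ℝ) := by nlinarith
  gcongr

/-- The probability `p̂_{j,n}(t)` that the `M/M/1` queue with arrival rate `lam` and service rate
`mu` moves from `j` to `n` customers in time `t`, in terms of Bessel functions. The series is over
`k = n + j + 2 + l`, `l ≥ 0`. -/
def mm1Prob (lam mu : ℝ) (j n : ℕ) (t : ℝ) : ℝ :=
  Real.exp (-(lam + mu) * t) *
    ((lam / mu) ^ (((n : ℝ) - j) / 2) * besselI ((n : ℤ) - j) (2 * t * √(lam * mu)) +
      (lam / mu) ^ (((n : ℝ) - j - 1) / 2) * besselI ((n : ℤ) + j + 1) (2 * t * √(lam * mu)) +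
      (1 - lam / mu) * (lam / mu) ^ n *
        ∑' l : ℕ, (mu / lam) ^ (((n + j + 2 + l : ℕ) : ℝ) / 2) *
          besselI ((n + j + 2 + l : ℕ) : ℤ) (2 * t * √(lam * mu)))

end

noncomputable section

/-! ### Transition functions with row-finite rates -/

namespace IsTransitionFunction

variable {S : Type*} [DecidableEq S] {P : ℝ≥0 → S → S → ℝ}

/-! Each state jumps to only finitely many others, so every transition function with the given rates
satisfies Kolmogorov's backward equations (`hasDerivAt_backward`). As the rates are bounded, a
bounded solution is determined by its initial value (`eq_zero_of_forall_hasDerivWithinAt`), and a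
transition probability is identified by checking the equations for its candidate.

For one queue the candidate comes from the method of images. After removal of the factor
exp(-(λ+μ)t) the equation is u_k' = λ u_{k+1} + μ u_{k-1}. The Laurent coefficients of exp(λts +
μt/s), which are Bessel functions up to powers of λ/μ, solve it on all of ℤ. The direct term, its
mirror image and a tail sum are combined so that u_{-1} = u_0, which is the reflection at the empty
queue (`mm1Laurent_neg_one`). The formula from state 0 follows by summing the Bessel recurrence over
a tail.

Environment 2 is never left, so the queue there is an ordinary one. Seen from environment 1, the
switch is killing at rate η₁, whence the factor exp(-η₁t). For the passage from 1 to 2, the killed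
law R (forward equation, obtained from the backward one by detailed balance) is paired with the
backward solution v: integrating the derivative of ∑_{l≤L} R_l(τ) v_l(t-τ) produces the switching
integrals up to a flux through level L, which vanishes as L → ∞ (`hasSum_integral_one_two`). -/

theorem le_one (hP : IsTransitionFunction P) (t : ℝ≥0) (x y : S) : P t x y ≤ 1 :=
  le_hasSum (hP.hasSum_one t x) y fun _ _ => hP.nonneg t x _

theorem sum_mul_le (hP : IsTransitionFunction P) (h t : ℝ≥0) (x y : S) (F : Finset S) :
    ∑ z ∈ F, P h x z * P t z y ≤ P (h + t) x y :=
  sum_le_hasSum F (fun _ _ => mul_nonneg (hP.nonneg _ _ _) (hP.nonneg _ _ _))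
    (hP.chapman_kolmogorov h t x y)

/-- The terms P h x z * (1 - P t z y) are nonnegative, so a partial sum is at most the total.
Truncating Chapman–Kolmogorov to `F` thus costs no more than the mass outside `F`. -/
theorem sub_sum_mul_le (hP : IsTransitionFunction P) (h t : ℝ≥0) (x y : S) (F : Finset S) :
    P (h + t) x y - ∑ z ∈ F, P h x z * P t z y ≤ 1 - ∑ z ∈ F, P h x z := by
  have h1 := (hP.hasSum_one h x).sub (hP.chapman_kolmogorov h t x y)
  have h2 := sum_le_hasSum F (fun z _ => ?_) h1
  · rw [Finset.sum_sub_distrib] at h2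
    linarith
  · nlinarith [hP.nonneg h x z, hP.le_one t z y]

theorem abs_sub_le (hP : IsTransitionFunction P) (h t : ℝ≥0) (x y : S) :
    |P (h + t) x y - P t x y| ≤ 1 - P h x x := by
  have h1 := hP.sum_mul_le h t x y {x}
  have h2 := hP.sub_sum_mul_le h t x y {x}
  simp only [Finset.sum_singleton] at h1 h2
  have h3 := hP.le_one h x x
  have h4 := hP.le_one t x y
  have h5 := hP.nonneg t x y
  rw [abs_le]
  constructor <;> nlinarith

theorem tendsto_diag (hP : IsTransitionFunction P) {Q : S → S → ℝ} (hQ : HasQMatrix P Q) (x : S) :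
    Tendsto (fun h => P h x x) (𝓝 0) (𝓝 1) := by
  have h1 : Tendsto (fun h : ℝ≥0 => P h x x) (𝓝[>] 0) (𝓝 1) := by
    have h2 : Tendsto (fun h : ℝ≥0 => (h : ℝ)) (𝓝[>] 0) (𝓝 0) :=
      (NNReal.continuous_coe.tendsto' 0 0 rfl).mono_left nhdsWithin_le_nhds
    have h3 := ((hQ x x).mul h2).add_const 1
    rw [mul_zero, zero_add] at h3
    refine h3.congr' ?_
    filter_upwards [self_mem_nhdsWithin] with h hh
    have : (h : ℝ) ≠ 0 := (NNReal.coe_pos.mpr hh).ne'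
    rw [if_pos rfl, div_mul_cancel₀ _ this]
    ring
  have h4 : (𝓝 (0 : ℝ≥0)) = 𝓝[>] 0 ⊔ pure 0 := by
    rw [sup_comm, ← nhdsWithin_singleton, ← nhdsWithin_union]
    have : ({0} ∪ Set.Ioi 0 : Set ℝ≥0) = Set.univ := by
      ext z
      simp
    rw [this, nhdsWithin_univ]
  rw [h4]
  refine h1.sup ?_
  have h5 : P 0 x x = 1 := by rw [hP.zero, if_pos rfl]
  rw [← h5]
  exact tendsto_pure_nhds _ _

theorem continuous (hP : IsTransitionFunction P) {Q : S → S → ℝ} (hQ : HasQMatrix P Q) (x y : S) :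
    Continuous fun t => P t x y := by
  rw [continuous_iff_continuousAt]
  intro t
  rw [ContinuousAt, tendsto_iff_dist_tendsto_zero]
  -- With truncated subtraction, `s - t + (t - s)` is |s - t|.
  have h1 : Tendsto (fun s : ℝ≥0 => 1 - P (s - t + (t - s)) x x) (𝓝 t) (𝓝 0) := by
    have h2 : Tendsto (fun s : ℝ≥0 => s - t + (t - s)) (𝓝 t) (𝓝 0) := by
      have : Continuous fun s : ℝ≥0 => s - t + (t - s) := by fun_prop
      exact this.tendsto' t 0 (by simp)
    simpa using ((hP.tendsto_diag hQ x).comp h2).const_sub 1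
  refine squeeze_zero (fun _ => dist_nonneg) (fun s => ?_) h1
  rw [Real.dist_eq]
  rcases le_total s t with h | h
  · rw [tsub_eq_zero_of_le h, zero_add, abs_sub_comm]
    simpa [tsub_add_cancel_of_le h] using hP.abs_sub_le (t - s) s x y
  · rw [tsub_eq_zero_of_le h, add_zero]
    simpa [tsub_add_cancel_of_le h] using hP.abs_sub_le (s - t) t x y

theorem continuous_toNNReal (hP : IsTransitionFunction P) {Q : S → S → ℝ} (hQ : HasQMatrix P Q)
    (x y : S) : Continuous fun t : ℝ => P t.toNNReal x y :=
  (hP.continuous hQ x y).comp continuous_real_toNNReal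

end IsTransitionFunction

/-! ### Kolmogorov's backward equation -/

theorem qMatrix_self {S : Type*} [DecidableEq S] (r : S → S → ℝ) {x : S} {F : Finset S}
    (hx : x ∉ F) (hr : ∀ z, z ≠ x → z ∉ F → r x z = 0) :
    qMatrix r x x = -∑ z ∈ F, r x z := by
  rw [qMatrix, if_pos rfl]
  congr 1
  have h1 := tsum_subtype {z : S | z ≠ x} (r x)
  refine h1.trans ?_
  rw [tsum_eq_sum (s := F)]
  · refine Finset.sum_congr rfl fun z hz => ?_
    rw [Set.indicator_of_mem]
    rintro rfl
    exact hx hz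
  · intro z hz
    by_cases h : z = x
    · simp [h]
    · rw [Set.indicator_of_mem (by exact h), hr z h hz]

theorem qMatrix_of_ne {S : Type*} [DecidableEq S] (r : S → S → ℝ) {x y : S} (h : x ≠ y) :
    qMatrix r x y = r x y := if_neg h

namespace IsTransitionFunction

variable {S : Type*} [DecidableEq S] {P : ℝ≥0 → S → S → ℝ}

/-- Squeeze: Chapman–Kolmogorov truncated to `insert x F` bounds the quotient from below, and adding
the mass that escapes this finite set bounds it from above. -/
theorem tendsto_backward (hP : IsTransitionFunction P) {r : S → S → ℝ}
    (hQ : HasQMatrix P (qMatrix r)) {x : S} {F : Finset S} (hx : x ∉ F)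
    (hr : ∀ z, z ≠ x → z ∉ F → r x z = 0) (t : ℝ≥0) (y : S) :
    Tendsto (fun h : ℝ≥0 => (P (h + t) x y - P t x y) / (h : ℝ)) (𝓝[>] 0)
      (𝓝 (∑ z ∈ F, r x z * (P t z y - P t x y))) := by
  have hd : Tendsto (fun h : ℝ≥0 => (P h x x - 1) / (h : ℝ)) (𝓝[>] 0) (𝓝 (-∑ z ∈ F, r x z)) := by
    simpa [qMatrix_self r hx hr] using hQ x x
  have ho : ∀ z ∈ F, Tendsto (fun h : ℝ≥0 => P h x z / (h : ℝ)) (𝓝[>] 0) (𝓝 (r x z)) := by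
    intro z hz
    have hne : x ≠ z := by rintro rfl; exact hx hz
    simpa [qMatrix_of_ne r hne, hne] using hQ x z
  have hmain : Tendsto (fun h : ℝ≥0 => (P h x x - 1) / (h : ℝ) * P t x y +
      ∑ z ∈ F, P h x z / (h : ℝ) * P t z y) (𝓝[>] 0)
      (𝓝 (∑ z ∈ F, r x z * (P t z y - P t x y))) := by
    have := (hd.mul_const (P t x y)).add
      (tendsto_finsetSum F fun z hz => (ho z hz).mul_const (P t z y))
    convert this using 2
    rw [neg_mul, Finset.sum_mul, neg_add_eq_sub, ← Finset.sum_sub_distrib]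
    simp only [mul_sub]
  -- The escaping mass is o(h), because the diagonal rate balances exactly the rates into `F`.
  have hrem : Tendsto (fun h : ℝ≥0 => -((P h x x - 1) / (h : ℝ)) - ∑ z ∈ F, P h x z / (h : ℝ))
      (𝓝[>] 0) (𝓝 0) := by
    simpa using hd.neg.sub (tendsto_finsetSum F ho)
  refine tendsto_of_tendsto_of_tendsto_of_le_of_le' hmain
    (by simpa using hmain.add hrem) ?_ ?_
  · filter_upwards [self_mem_nhdsWithin] with h hh
    have hpos : (0 : ℝ) < h := NNReal.coe_pos.mpr hh
    have h1 := hP.sum_mul_le h t x y (insert x F)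
    rw [Finset.sum_insert hx] at h1
    simp only [div_mul_eq_mul_div]
    rw [← Finset.sum_div, ← add_div]
    gcongr
    linarith
  · filter_upwards [self_mem_nhdsWithin] with h hh
    have hpos : (0 : ℝ) < h := NNReal.coe_pos.mpr hh
    have h1 := hP.sub_sum_mul_le h t x y (insert x F)
    rw [Finset.sum_insert hx, Finset.sum_insert hx] at h1
    simp only [div_mul_eq_mul_div]
    rw [← Finset.sum_div, ← Finset.sum_div, ← neg_div, ← sub_div, ← add_div, ← add_div]
    gcongr
    linarith

/-- Kolmogorov's backward equation, for right derivatives. -/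
theorem hasDerivWithinAt_backward (hP : IsTransitionFunction P) {r : S → S → ℝ}
    (hQ : HasQMatrix P (qMatrix r)) {x : S} {F : Finset S} (hx : x ∉ F)
    (hr : ∀ z, z ≠ x → z ∉ F → r x z = 0) (y : S) {t : ℝ} (ht : 0 ≤ t) :
    HasDerivWithinAt (fun s : ℝ => P s.toNNReal x y)
      (∑ z ∈ F, r x z * (P t.toNNReal z y - P t.toNNReal x y)) (Set.Ici t) t := by
  rw [← hasDerivWithinAt_Ioi_iff_Ici, hasDerivWithinAt_iff_tendsto_slope' (by simp)]
  have h1 : Tendsto (fun s : ℝ => (s - t).toNNReal) (𝓝[>] t) (𝓝[>] 0) := by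
    refine tendsto_nhdsWithin_iff.mpr ⟨?_, ?_⟩
    · have : Continuous fun s : ℝ => (s - t).toNNReal := by fun_prop
      exact (this.tendsto' t 0 (by simp)).mono_left nhdsWithin_le_nhds
    · filter_upwards [self_mem_nhdsWithin] with s hs
      simpa using hs
  refine ((hP.tendsto_backward hQ hx hr t.toNNReal y).comp h1).congr' ?_
  filter_upwards [self_mem_nhdsWithin] with s hs
  have hs' : t < s := hs
  have h2 : (s - t).toNNReal + t.toNNReal = s.toNNReal := by
    rw [← Real.toNNReal_add (by linarith) ht, sub_add_cancel]
  rw [Function.comp_apply, h2, Real.coe_toNNReal _ (by linarith), slope_def_field]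

end IsTransitionFunction

/-- Subtracting the integral of `g` leaves a continuous function with zero right derivative, hence a
constant; so `f` is a true antiderivative. -/
theorem hasDerivAt_of_hasDerivWithinAt_Ici {f g : ℝ → ℝ} (hf : Continuous f) (hg : Continuous g)
    {a : ℝ} (h : ∀ t, a ≤ t → HasDerivWithinAt f (g t) (Set.Ici t) t) {t : ℝ} (ht : a < t) :
    HasDerivAt f (g t) t := by
  have hG : ∀ s, HasDerivAt (fun s => ∫ u in a..s, g u) (g s) s := fun s =>
    hg.integral_hasStrictDerivAt a s |>.hasDerivAt
  have hc : ∀ s, a ≤ s → f s = f a + ∫ u in a..s, g u := by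
    intro s hs
    have h1 := constant_of_has_deriv_right_zero (f := fun s => f s - ∫ u in a..s, g u)
      (a := a) (b := s)
      (hf.sub (continuous_iff_continuousAt.mpr fun s => (hG s).continuousAt)).continuousOn
      (fun u hu => ((h u hu.1).sub (hG u).hasDerivWithinAt).congr_deriv (sub_self _)) s
      ⟨hs, le_rfl⟩
    simp only [intervalIntegral.integral_same] at h1
    linarith
  refine ((hG t).const_add (f a)).congr_of_eventuallyEq ?_
  filter_upwards [lt_mem_nhds ht] with s hs using hc s hs.le

namespace IsTransitionFunction

variable {S : Type*} [DecidableEq S] {P : ℝ≥0 → S → S → ℝ}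

/-- Kolmogorov's backward equation. -/
theorem hasDerivAt_backward (hP : IsTransitionFunction P) {r : S → S → ℝ}
    (hQ : HasQMatrix P (qMatrix r)) {x : S} {F : Finset S} (hx : x ∉ F)
    (hr : ∀ z, z ≠ x → z ∉ F → r x z = 0) (y : S) {t : ℝ} (ht : 0 < t) :
    HasDerivAt (fun s : ℝ => P s.toNNReal x y)
      (∑ z ∈ F, r x z * (P t.toNNReal z y - P t.toNNReal x y)) t := by
  refine hasDerivAt_of_hasDerivWithinAt_Ici (hP.continuous_toNNReal hQ x y)
    (g := fun t => ∑ z ∈ F, r x z * (P t.toNNReal z y - P t.toNNReal x y)) ?_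
    (fun s hs => hP.hasDerivWithinAt_backward hQ hx hr y hs) ht
  exact continuous_finsetSum _ fun z _ => continuous_const.mul
    ((hP.continuous_toNNReal hQ z y).sub (hP.continuous_toNNReal hQ x y))

/-- The chain may wait in `x` for the extra time `t - s`, with probability at least exp(-q(t - s)).
The resulting comparison of two times has a constant independent of `y`. -/
theorem exp_mul_le_exp_mul (hP : IsTransitionFunction P) {r : S → S → ℝ}
    (hQ : HasQMatrix P (qMatrix r)) {x : S} {F : Finset S} (hx : x ∉ F)
    (hr : ∀ z, z ≠ x → z ∉ F → r x z = 0) (hr0 : ∀ z, 0 ≤ r x z) (y : S) {s t : ℝ} (hs : 0 ≤ s)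
    (hst : s ≤ t) :
    Real.exp ((∑ z ∈ F, r x z) * s) * P s.toNNReal x y ≤
      Real.exp ((∑ z ∈ F, r x z) * t) * P t.toNNReal x y := by
  set q := ∑ z ∈ F, r x z with hq
  have hmono : MonotoneOn (fun t : ℝ => Real.exp (q * t) * P t.toNNReal x y) (Set.Ici 0) := by
    refine monotoneOn_of_hasDerivWithinAt_nonneg (convex_Ici 0)
      (f' := fun t => Real.exp (q * t) * q * P t.toNNReal x y +
        Real.exp (q * t) * ∑ z ∈ F, r x z * (P t.toNNReal z y - P t.toNNReal x y)) ?_ ?_ ?_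
    · have h1 : Continuous fun t : ℝ => Real.exp (q * t) := by fun_prop
      exact (h1.mul (hP.continuous_toNNReal hQ x y)).continuousOn
    · intro t ht
      rw [interior_Ici] at ht
      have h1 : HasDerivAt (fun t : ℝ => Real.exp (q * t)) (Real.exp (q * t) * q) t := by
        simpa using ((hasDerivAt_id t).const_mul q).exp
      exact (h1.mul (hP.hasDerivAt_backward hQ hx hr y ht)).hasDerivWithinAt
    · intro t _
      have h2 : ∑ z ∈ F, r x z * (P t.toNNReal z y - P t.toNNReal x y) =
          ∑ z ∈ F, r x z * P t.toNNReal z y - q * P t.toNNReal x y := by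
        rw [hq, Finset.sum_mul, ← Finset.sum_sub_distrib]
        simp only [mul_sub]
      have h3 : 0 ≤ ∑ z ∈ F, r x z * P t.toNNReal z y :=
        Finset.sum_nonneg fun z _ => mul_nonneg (hr0 z) (hP.nonneg _ _ _)
      rw [h2]
      have := mul_nonneg (Real.exp_pos (q * t)).le h3
      linarith
  exact hmono hs (hs.trans hst : (0 : ℝ) ≤ t) hst

end IsTransitionFunction

/-- A bounded solution of a linear system of differential equations with bounded coefficients
vanishes if its initial value does. -/
theorem eq_zero_of_forall_hasDerivWithinAt {S : Type*} {u u' : S → ℝ → ℝ} {T C M : ℝ}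
    (hcont : ∀ x, ContinuousOn (u x) (Set.Icc 0 T))
    (hderiv : ∀ x, ∀ t ∈ Set.Ico 0 T, HasDerivWithinAt (u x) (u' x t) (Set.Ici t) t)
    (hbound : ∀ x, ∀ t ∈ Set.Ico 0 T, ∀ B, (∀ z, |u z t| ≤ B) → |u' x t| ≤ C * B)
    (hM : ∀ x, ∀ t ∈ Set.Icc 0 T, |u x t| ≤ M) (hzero : ∀ x, u x 0 = 0)
    (x : S) {t : ℝ} (ht : t ∈ Set.Icc 0 T) : u x t = 0 := by
  -- Picard iteration: the bound for `n + 1` has derivative `C` times the bound for `n`.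
  have key : ∀ n : ℕ, ∀ x, ∀ t ∈ Set.Icc 0 T, |u x t| ≤ M * ((C * t) ^ n / n !) := by
    intro n
    induction n with
    | zero => simpa using hM
    | succ n ih =>
      intro x t ht
      refine image_norm_le_of_norm_deriv_right_le_deriv_boundary' (f := u x) (f' := u' x)
        (B := fun t => M * ((C * t) ^ (n + 1) / (n + 1)!))
        (B' := fun t => C * (M * ((C * t) ^ n / n !))) (hcont x) (hderiv x) ?_ ?_ ?_ ?_ ht
      · simp [hzero]
      · fun_prop
      · intro s _
        have h1 := ((((hasDerivAt_id s).const_mul C).pow (n + 1)).div_const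
          ((n + 1)! : ℝ)).const_mul M
        refine (h1.congr_deriv ?_).hasDerivWithinAt
        have : (n ! : ℝ) ≠ 0 := by positivity
        rw [Nat.factorial_succ]
        push_cast
        simp only [id]
        field_simp
      · exact fun s hs => hbound x s hs _ fun z => ih z s ⟨hs.1, hs.2.le⟩
  have hlim : Tendsto (fun n : ℕ => M * ((C * t) ^ n / n !)) atTop (𝓝 0) := by
    simpa using (FloorSemiring.tendsto_pow_div_factorial_atTop (C * t)).const_mul M
  have := ge_of_tendsto' hlim fun n => key n x t ht
  exact abs_eq_zero.mp (le_antisymm this (abs_nonneg _))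

/-! ### The Laurent coefficients of `exp (lam * t * s + mu * t / s)` -/

/-- The coefficient of `s ^ k` in the power series of `exp (x * s)`; it is zero for `k < 0`. -/
def expCoeff (k : ℤ) (x : ℝ) : ℝ := if 0 ≤ k then x ^ k.toNat / (k.toNat)! else 0

theorem expCoeff_natCast (k : ℕ) (x : ℝ) : expCoeff k x = x ^ k / k ! := by
  simp [expCoeff]

theorem expCoeff_of_neg {k : ℤ} (h : k < 0) (x : ℝ) : expCoeff k x = 0 := if_neg h.not_ge

theorem expCoeff_nonneg (k : ℤ) {x : ℝ} (hx : 0 ≤ x) : 0 ≤ expCoeff k x := by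
  rw [expCoeff]
  split_ifs <;> positivity

theorem expCoeff_le_exp (k : ℤ) {x : ℝ} (hx : 0 ≤ x) : expCoeff k x ≤ Real.exp x := by
  rw [expCoeff]
  split_ifs
  · exact Real.pow_div_factorial_le_exp x hx _
  · positivity

theorem abs_expCoeff_le (k : ℤ) {x y : ℝ} (h : |x| ≤ y) : |expCoeff k x| ≤ expCoeff k y := by
  simp only [expCoeff]
  split_ifs
  · rw [abs_div, abs_pow, Nat.abs_cast]
    gcongr
  · simp

theorem hasDerivAt_expCoeff (k : ℤ) (x : ℝ) : HasDerivAt (expCoeff k) (expCoeff (k - 1) x) x := by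
  rcases lt_trichotomy k 0 with h | rfl | h
  · rw [expCoeff_of_neg (by omega), show expCoeff k = fun _ => 0 from funext (expCoeff_of_neg h)]
    exact hasDerivAt_const _ _
  · rw [expCoeff_of_neg (by omega), show expCoeff 0 = fun _ => 1 from funext fun x => by
      simp [expCoeff]]
    exact hasDerivAt_const _ _
  · obtain ⟨n, rfl⟩ : ∃ n : ℕ, k = (n + 1 : ℕ) := ⟨(k - 1).toNat, by omega⟩
    rw [show ((n + 1 : ℕ) : ℤ) - 1 = n by push_cast; ring, expCoeff_natCast,
      show expCoeff (n + 1 : ℕ) = fun x : ℝ => x ^ (n + 1) / (n + 1)! from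
        funext (expCoeff_natCast (n + 1))]
    refine ((hasDerivAt_pow (n + 1) x).div_const _).congr_deriv ?_
    have : (n ! : ℝ) ≠ 0 := by positivity
    rw [Nat.factorial_succ]
    push_cast
    field_simp

theorem mul_expCoeff (k : ℤ) (x : ℝ) : k * expCoeff k x = x * expCoeff (k - 1) x := by
  rcases lt_trichotomy k 0 with h | rfl | h
  · rw [expCoeff_of_neg h, expCoeff_of_neg (by omega), mul_zero, mul_zero]
  · rw [expCoeff_of_neg (by omega : (0 : ℤ) - 1 < 0)]
    simp
  · obtain ⟨n, rfl⟩ : ∃ n : ℕ, k = (n + 1 : ℕ) := ⟨(k - 1).toNat, by omega⟩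
    rw [show ((n + 1 : ℕ) : ℤ) - 1 = n by push_cast; ring, expCoeff_natCast, expCoeff_natCast]
    have : (n ! : ℝ) ≠ 0 := by positivity
    rw [Nat.factorial_succ]
    push_cast
    field_simp
    ring

theorem summable_expCoeff (x : ℝ) : Summable fun i : ℕ => expCoeff i x := by
  simpa only [expCoeff_natCast] using Real.summable_pow_div_factorial x

theorem tsum_expCoeff (x : ℝ) : ∑' i : ℕ, expCoeff i x = Real.exp x := by
  simp only [expCoeff_natCast, Real.exp_eq_exp_ℝ, NormedSpace.exp_eq_tsum_div]

theorem expCoeff_natCast_add_le (i j : ℕ) {x : ℝ} (hx : 0 ≤ x) :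
    expCoeff ((i : ℤ) + j) x ≤ expCoeff i x * expCoeff j x := by
  rw [← Nat.cast_add, expCoeff_natCast, expCoeff_natCast, expCoeff_natCast, div_mul_div_comm,
    ← pow_add]
  have : (i ! : ℝ) * j ! ≤ (i + j)! := by
    exact_mod_cast Nat.le_of_dvd (Nat.factorial_pos _)
      (Nat.factorial_mul_factorial_dvd_factorial_add i j)
  gcongr

/-- The coefficient of `s ^ m` in the Laurent series of `exp (lam * t * s + mu * t / s)`. -/
def expLaurent (lam mu : ℝ) (m : ℤ) (t : ℝ) : ℝ :=
  ∑' i : ℕ, expCoeff (i + m) (lam * t) * expCoeff i (mu * t)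

section

variable {lam mu : ℝ}

theorem abs_mul_le_mul_of_abs_le {a t T : ℝ} (ha : 0 ≤ a) (ht : |t| ≤ T) : |a * t| ≤ a * T := by
  rw [abs_mul, abs_of_nonneg ha]
  gcongr

theorem abs_expCoeff_mul_expCoeff_le (hlam : 0 ≤ lam) (hmu : 0 ≤ mu) {t T : ℝ} (ht : |t| ≤ T)
    (k i : ℤ) :
    |expCoeff k (lam * t) * expCoeff i (mu * t)| ≤
      expCoeff k (lam * T) * expCoeff i (mu * T) := by
  have hT : 0 ≤ T := (abs_nonneg t).trans ht
  rw [abs_mul]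
  exact mul_le_mul (abs_expCoeff_le k (abs_mul_le_mul_of_abs_le hlam ht))
    (abs_expCoeff_le i (abs_mul_le_mul_of_abs_le hmu ht)) (abs_nonneg _)
    (expCoeff_nonneg k (mul_nonneg hlam hT))

theorem expCoeff_mul_expCoeff_le (hlam : 0 ≤ lam) (hmu : 0 ≤ mu) {T : ℝ} (hT : 0 ≤ T) (k i : ℤ) :
    expCoeff k (lam * T) * expCoeff i (mu * T) ≤ Real.exp (lam * T) * expCoeff i (mu * T) :=
  mul_le_mul_of_nonneg_right (expCoeff_le_exp k (mul_nonneg hlam hT))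
    (expCoeff_nonneg i (mul_nonneg hmu hT))

theorem summable_expLaurent (hlam : 0 ≤ lam) (hmu : 0 ≤ mu) (m : ℤ) (t : ℝ) :
    Summable fun i : ℕ => expCoeff (i + m) (lam * t) * expCoeff i (mu * t) :=
  Summable.of_norm_bounded ((summable_expCoeff (mu * |t|)).mul_left (Real.exp (lam * |t|)))
    fun _ => (abs_expCoeff_mul_expCoeff_le hlam hmu le_rfl _ _).trans
      (expCoeff_mul_expCoeff_le hlam hmu (abs_nonneg t) _ _)

theorem expLaurent_nonneg (hlam : 0 ≤ lam) (hmu : 0 ≤ mu) (m : ℤ) {t : ℝ} (ht : 0 ≤ t) :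
    0 ≤ expLaurent lam mu m t :=
  tsum_nonneg fun _ => mul_nonneg (expCoeff_nonneg _ (mul_nonneg hlam ht))
    (expCoeff_nonneg _ (mul_nonneg hmu ht))

theorem abs_expLaurent_le (hlam : 0 ≤ lam) (hmu : 0 ≤ mu) (m : ℤ) {t T : ℝ} (ht : |t| ≤ T) :
    |expLaurent lam mu m t| ≤ expLaurent lam mu m T :=
  tsum_of_norm_bounded (f := fun i : ℕ => expCoeff (i + m) (lam * t) * expCoeff i (mu * t))
    (summable_expLaurent hlam hmu m T).hasSum fun i =>
      abs_expCoeff_mul_expCoeff_le hlam hmu ht (i + m) i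

theorem expLaurent_le_exp (hlam : 0 ≤ lam) (hmu : 0 ≤ mu) (m : ℤ) {t : ℝ} (ht : 0 ≤ t) :
    expLaurent lam mu m t ≤ Real.exp (lam * t) * Real.exp (mu * t) := by
  rw [← tsum_expCoeff (mu * t), ← tsum_mul_left]
  exact (summable_expLaurent hlam hmu m t).tsum_le_tsum
    (fun _ => expCoeff_mul_expCoeff_le hlam hmu ht _ _) ((summable_expCoeff _).mul_left _)

theorem hasSum_expCoeff_mul_pred (hlam : 0 ≤ lam) (hmu : 0 ≤ mu) (m : ℤ) (t : ℝ) :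
    HasSum (fun i : ℕ => expCoeff (i + m) (lam * t) * expCoeff ((i : ℤ) - 1) (mu * t))
      (expLaurent lam mu (m + 1) t) := by
  rw [← hasSum_nat_add_iff' 1]
  simp only [Finset.range_one, Finset.sum_singleton]
  rw [expCoeff_of_neg (by simp : ((0 : ℕ) : ℤ) - 1 < 0), mul_zero, sub_zero]
  refine (summable_expLaurent hlam hmu (m + 1) t).hasSum.congr_fun fun i => ?_
  rw [Nat.cast_succ, add_sub_cancel_right, add_assoc, add_comm 1 m]

/-- Differentiation in t multiplies the generating function by λs + μ/s. Termwise differentiation is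
justified on |s| < |t| + 1, where values at the radius dominate. -/
theorem hasDerivAt_expLaurent (hlam : 0 ≤ lam) (hmu : 0 ≤ mu) (m : ℤ) (t : ℝ) :
    HasDerivAt (expLaurent lam mu m)
      (lam * expLaurent lam mu (m - 1) t + mu * expLaurent lam mu (m + 1) t) t := by
  have hs1 := (summable_expLaurent hlam hmu (m - 1) t).hasSum.mul_left lam
  have hs2 := (hasSum_expCoeff_mul_pred hlam hmu m t).mul_left mu
  set T := |t| + 1 with hT
  have hT0 : 0 ≤ T := by positivity
  have hb1 := ((summable_expCoeff (mu * T)).mul_left (Real.exp (lam * T))).mul_left lam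
  have hb2 := ((hasSum_expCoeff_mul_pred hlam hmu m T).mul_left mu).summable
  refine (hasDerivAt_tsum_of_isPreconnected (hb1.add hb2) (Metric.isOpen_ball (x := (0 : ℝ))
    (ε := T)) (convex_ball 0 T).isPreconnected
    (g := fun (i : ℕ) t => expCoeff (i + m) (lam * t) * expCoeff i (mu * t))
    (g' := fun (i : ℕ) t => lam * (expCoeff (i + (m - 1)) (lam * t) * expCoeff i (mu * t)) +
      mu * (expCoeff (i + m) (lam * t) * expCoeff ((i : ℤ) - 1) (mu * t)))
    ?_ ?_ (y₀ := t) ?_ (summable_expLaurent hlam hmu m t) ?_).congr_deriv ?_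
  · intro i s _
    have h1 := (hasDerivAt_expCoeff (i + m) (lam * s)).comp s ((hasDerivAt_id s).const_mul lam)
    have h2 := (hasDerivAt_expCoeff i (mu * s)).comp s ((hasDerivAt_id s).const_mul mu)
    refine (h1.mul h2).congr_deriv ?_
    simp only [Function.comp_apply]
    rw [add_sub_assoc]
    ring
  · intro i s hs
    have hs' : |s| ≤ T := by simpa using (mem_ball_zero_iff.mp hs).le
    refine (norm_add_le _ _).trans (add_le_add ?_ ?_)
    · rw [Real.norm_eq_abs, abs_mul, abs_of_nonneg hlam]
      gcongr
      exact (abs_expCoeff_mul_expCoeff_le hlam hmu hs' _ _).trans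
        (expCoeff_mul_expCoeff_le hlam hmu hT0 _ _)
    · rw [Real.norm_eq_abs, abs_mul, abs_of_nonneg hmu]
      gcongr
      exact abs_expCoeff_mul_expCoeff_le hlam hmu hs' _ _
  · simp [hT]
  · simp [hT]
  · exact (hs1.add hs2).tsum_eq

/-- The Bessel recurrence: apply s d/ds to the generating function, that is, write m = (i + m) - i
in each term. -/
theorem mul_expLaurent (hlam : 0 ≤ lam) (hmu : 0 ≤ mu) (m : ℤ) (t : ℝ) :
    m * expLaurent lam mu m t =
      lam * t * expLaurent lam mu (m - 1) t - mu * t * expLaurent lam mu (m + 1) t := by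
  have hs0 := (summable_expLaurent hlam hmu m t).hasSum.mul_left (m : ℝ)
  have hs1 := (summable_expLaurent hlam hmu (m - 1) t).hasSum.mul_left (lam * t)
  have hs2 := (hasSum_expCoeff_mul_pred hlam hmu m t).mul_left (mu * t)
  refine hs0.unique ((hs1.sub hs2).congr_fun ?_)
  intro i
  have h1 := mul_expCoeff (i + m) (lam * t)
  have h2 := mul_expCoeff i (mu * t)
  rw [add_sub_assoc] at h1
  push_cast at h1 h2
  linear_combination expCoeff i (mu * t) * h1 - expCoeff (i + m) (lam * t) * h2

theorem expLaurent_zero_right (lam mu : ℝ) (m : ℤ) :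
    expLaurent lam mu m 0 = if m = 0 then 1 else 0 := by
  rw [expLaurent, tsum_eq_single 0]
  · rcases lt_trichotomy m 0 with h | rfl | h
    · rw [if_neg h.ne, expCoeff_of_neg (by simpa using h), zero_mul]
    · simp [expCoeff]
    · obtain ⟨n, rfl⟩ : ∃ n : ℕ, m = (n + 1 : ℕ) := ⟨(m - 1).toNat, by omega⟩
      rw [if_neg h.ne']
      simp only [Nat.cast_zero, zero_add, mul_zero, expCoeff_natCast]
      simp
  · intro i hi
    rw [mul_zero mu, expCoeff_natCast, zero_pow hi]
    simp

theorem expLaurent_swap_natCast (hlam : 0 ≤ lam) (hmu : 0 ≤ mu) (m : ℕ) (t : ℝ) :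
    expLaurent lam mu (-(m : ℤ)) t = expLaurent mu lam m t := by
  rw [expLaurent, ← (summable_expLaurent hlam hmu (-(m : ℤ)) t).sum_add_tsum_nat_add m,
    Finset.sum_eq_zero, zero_add, expLaurent]
  · refine tsum_congr fun i => ?_
    rw [mul_comm]
    push_cast
    rw [add_neg_cancel_right]
  · intro i hi
    rw [expCoeff_of_neg, zero_mul]
    have := Finset.mem_range.mp hi
    omega

theorem expLaurent_swap (hlam : 0 ≤ lam) (hmu : 0 ≤ mu) (m : ℤ) (t : ℝ) :
    expLaurent lam mu (-m) t = expLaurent mu lam m t := by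
  obtain ⟨n, rfl | rfl⟩ := m.eq_nat_or_neg
  · exact expLaurent_swap_natCast hlam hmu n t
  · rw [neg_neg, expLaurent_swap_natCast hmu hlam]

theorem expCoeff_mul_left (c : ℝ) (k : ℤ) (x : ℝ) : expCoeff k (c * x) = c ^ k * expCoeff k x := by
  rcases lt_or_ge k 0 with h | h
  · rw [expCoeff_of_neg h, expCoeff_of_neg h, mul_zero]
  · obtain ⟨n, rfl⟩ := Int.eq_ofNat_of_zero_le h
    rw [expCoeff_natCast, expCoeff_natCast, zpow_natCast, mul_pow, mul_div_assoc]

/-- The generating function is invariant under s ↦ μ/(λs). -/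
theorem expLaurent_reflect (hlam : 0 < lam) (hmu : 0 < mu) (m : ℤ) (t : ℝ) :
    expLaurent lam mu m t = (lam / mu) ^ m * expLaurent lam mu (-m) t := by
  rw [expLaurent_swap hlam.le hmu.le, expLaurent, expLaurent, ← tsum_mul_left]
  refine tsum_congr fun i => ?_
  simp only [expCoeff_mul_left]
  rw [div_zpow, zpow_add₀ hlam.ne', zpow_add₀ hmu.ne']
  have := zpow_ne_zero m hmu.ne'
  field_simp

theorem rpow_mul_besselI (hlam : 0 < lam) (hmu : 0 < mu) (m : ℤ) (t : ℝ) :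
    (lam / mu) ^ ((m : ℝ) / 2) * besselI m (2 * t * √(lam * mu)) = expLaurent lam mu m t := by
  rw [besselI, ← tsum_mul_left, expLaurent]
  refine tsum_congr fun i => ?_
  have hz : 2 * t * √(lam * mu) / 2 = t * (√lam * √mu) := by
    rw [Real.sqrt_mul hlam.le]; ring
  rw [hz]
  have hl : 0 < √lam := Real.sqrt_pos.mpr hlam
  have hm : 0 < √mu := Real.sqrt_pos.mpr hmu
  have hr : (lam / mu) ^ ((m : ℝ) / 2) = (√lam / √mu) ^ m := by
    rw [← Real.sqrt_div hlam.le, Real.sqrt_eq_rpow, ← Real.rpow_intCast,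
      ← Real.rpow_mul (by positivity)]
    congr 1
    ring
  rw [hr]
  rcases lt_or_ge ((i : ℤ) + m) 0 with h | h
  · rw [expCoeff_of_neg h, zero_mul]
    -- The Gamma factor sits at a pole, where its value 0 makes the quotient 0, matching the
    -- vanishing `expCoeff`.
    obtain ⟨n, hn⟩ : ∃ n : ℕ, (i : ℤ) + m + 1 = -n := ⟨(-(i + m + 1)).toNat, by omega⟩
    have : (i : ℝ) + m + 1 = -n := by exact_mod_cast hn
    rw [this, Real.Gamma_neg_nat_eq_zero]
    simp
  · obtain ⟨q, hq⟩ := Int.eq_ofNat_of_zero_le h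
    have hq' : (i : ℝ) + m = q := by exact_mod_cast hq
    have hm' : m = q - i := by omega
    rw [hq', hq, Real.Gamma_nat_eq_factorial, expCoeff_natCast, expCoeff_natCast,
      show 2 * (i : ℤ) + m = ((q + i : ℕ) : ℤ) by push_cast; omega, zpow_natCast, hm',
      zpow_sub₀ (by positivity), zpow_natCast, zpow_natCast]
    have e1 : lam = √lam ^ 2 := (Real.sq_sqrt hlam.le).symm
    have e2 : mu = √mu ^ 2 := (Real.sq_sqrt hmu.le).symm
    generalize √lam = a at *
    generalize √mu = b at *
    rw [e1, e2]
    simp only [mul_pow, div_pow, pow_add, ← pow_mul, two_mul]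
    field_simp

end

/-! ### Tail sums of the Laurent coefficients -/

section

variable {lam mu : ℝ}

theorem rpow_mul_besselI_natCast (hlam : 0 < lam) (hmu : 0 < mu) (r : ℕ) (t : ℝ) :
    (mu / lam) ^ ((r : ℝ) / 2) * besselI (r : ℤ) (2 * t * √(lam * mu)) =
      expLaurent lam mu (-(r : ℤ)) t := by
  rw [expLaurent_swap hlam.le hmu.le, ← rpow_mul_besselI hmu hlam, mul_comm mu lam,
    Int.cast_natCast]

/-- From i! r! ≤ (i + r)!; the exponential-series factor makes the coefficients summable in `r`. -/
theorem expLaurent_neg_natCast_le (hlam : 0 ≤ lam) (hmu : 0 ≤ mu) (r : ℕ) {t : ℝ} (ht : 0 ≤ t) :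
    expLaurent lam mu (-(r : ℤ)) t ≤ expCoeff r (mu * t) * expLaurent mu lam 0 t := by
  rw [expLaurent_swap hlam hmu, expLaurent, expLaurent, ← tsum_mul_left]
  refine (summable_expLaurent hmu hlam r t).tsum_le_tsum (fun i => ?_)
    ((summable_expLaurent hmu hlam 0 t).mul_left _)
  have h1 := expCoeff_natCast_add_le i r (mul_nonneg hmu ht)
  have h2 := expCoeff_nonneg i (mul_nonneg hlam ht)
  rw [add_zero]
  calc _ ≤ _ := mul_le_mul_of_nonneg_right h1 h2
    _ = _ := by ring

theorem summable_expLaurent_neg_natCast (hlam : 0 ≤ lam) (hmu : 0 ≤ mu) (t : ℝ) :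
    Summable fun r : ℕ => expLaurent lam mu (-(r : ℤ)) t :=
  Summable.of_norm_bounded ((summable_expCoeff (mu * |t|)).mul_right (expLaurent mu lam 0 |t|))
    fun r => (abs_expLaurent_le hlam hmu _ le_rfl).trans
      (expLaurent_neg_natCast_le hlam hmu r (abs_nonneg t))

theorem summable_expLaurent_neg_add (hlam : 0 ≤ lam) (hmu : 0 ≤ mu) (x : ℤ) (t : ℝ) :
    Summable fun l : ℕ => expLaurent lam mu (-(x + l)) t := by
  obtain ⟨c, d, h⟩ : ∃ c d : ℕ, x + c = d := ⟨(-x).toNat, x.toNat, by omega⟩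
  rw [← summable_nat_add_iff c]
  refine ((summable_nat_add_iff d).mpr (summable_expLaurent_neg_natCast hlam hmu t)).congr ?_
  intro l
  congr 2
  push_cast
  omega

/-- The sum of the coefficients of `s ^ (-r)`, `r ≥ x`, in `exp (lam * t * s + mu * t / s)`. -/
def expLaurentTail (lam mu : ℝ) (x : ℤ) (t : ℝ) : ℝ := ∑' l : ℕ, expLaurent lam mu (-(x + l)) t

theorem expLaurentTail_eq_add (hlam : 0 ≤ lam) (hmu : 0 ≤ mu) (x : ℤ) (t : ℝ) :
    expLaurentTail lam mu x t =
      expLaurent lam mu (-x) t + expLaurentTail lam mu (x + 1) t := by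
  rw [expLaurentTail, (summable_expLaurent_neg_add hlam hmu x t).tsum_eq_zero_add, Nat.cast_zero,
    add_zero, expLaurentTail]
  congr 1
  refine tsum_congr fun l => ?_
  rw [Nat.cast_succ, add_right_comm, add_assoc]

theorem hasDerivAt_expLaurentTail (hlam : 0 ≤ lam) (hmu : 0 ≤ mu) (x : ℤ) (t : ℝ) :
    HasDerivAt (expLaurentTail lam mu x)
      (lam * expLaurentTail lam mu (x + 1) t + mu * expLaurentTail lam mu (x - 1) t) t := by
  have hs : ∀ s, HasSum (fun l : ℕ => lam * expLaurent lam mu (-(x + l) - 1) s +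
      mu * expLaurent lam mu (-(x + l) + 1) s)
      (lam * expLaurentTail lam mu (x + 1) s + mu * expLaurentTail lam mu (x - 1) s) := fun s => by
    refine (((summable_expLaurent_neg_add hlam hmu (x + 1) s).hasSum.mul_left lam).add
      ((summable_expLaurent_neg_add hlam hmu (x - 1) s).hasSum.mul_left mu)).congr_fun
      fun l => ?_
    rw [show -(x + 1 + (l : ℤ)) = -(x + l) - 1 by ring,
      show -(x - 1 + (l : ℤ)) = -(x + l) + 1 by ring]
  set T := |t| + 1 with hT
  refine (hasDerivAt_tsum_of_isPreconnected (hs T).summable (Metric.isOpen_ball (x := (0 : ℝ))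
    (ε := T)) (convex_ball 0 T).isPreconnected
    (g := fun (l : ℕ) => expLaurent lam mu (-(x + l)))
    (fun l s _ => hasDerivAt_expLaurent hlam hmu _ s) ?_ (y₀ := t) ?_
    (summable_expLaurent_neg_add hlam hmu x t) ?_).congr_deriv (hs t).tsum_eq
  · intro l s hs
    have hs' : |s| ≤ T := by simpa using (mem_ball_zero_iff.mp hs).le
    refine (norm_add_le _ _).trans (add_le_add ?_ ?_)
    · rw [Real.norm_eq_abs, abs_mul, abs_of_nonneg hlam]
      gcongr
      exact abs_expLaurent_le hlam hmu _ hs'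
    · rw [Real.norm_eq_abs, abs_mul, abs_of_nonneg hmu]
      gcongr
      exact abs_expLaurent_le hlam hmu _ hs'
  · simp [hT]
  · simp [hT]

theorem abs_expLaurentTail_le (hlam : 0 ≤ lam) (hmu : 0 ≤ mu) (x : ℤ) {t T : ℝ} (ht : |t| ≤ T) :
    |expLaurentTail lam mu x t| ≤ expLaurentTail lam mu x T :=
  tsum_of_norm_bounded (f := fun l : ℕ => expLaurent lam mu (-(x + l)) t)
    (summable_expLaurent_neg_add hlam hmu x T).hasSum
    fun _ => abs_expLaurent_le hlam hmu _ ht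

theorem expLaurentTail_natCast_le (hlam : 0 ≤ lam) (hmu : 0 ≤ mu) (x : ℕ) {t : ℝ} (ht : 0 ≤ t) :
    expLaurentTail lam mu x t ≤ expLaurentTail lam mu 0 t := by
  have hs := summable_expLaurent_neg_add hlam hmu 0 t
  rw [expLaurentTail, expLaurentTail, ← hs.sum_add_tsum_nat_add x]
  have h1 : ∀ l : ℕ, -((0 : ℤ) + (l + x : ℕ)) = -((x : ℤ) + l) := fun l => by push_cast; ring
  simp only [h1]
  exact le_add_of_nonneg_left (Finset.sum_nonneg fun i _ => expLaurent_nonneg hlam hmu _ ht)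

theorem expLaurentTail_zero_right (lam mu : ℝ) {x : ℤ} (hx : 0 < x) :
    expLaurentTail lam mu x 0 = 0 := by
  rw [expLaurentTail]
  refine (tsum_congr fun l => ?_).trans tsum_zero
  rw [expLaurent_zero_right, if_neg]
  omega

/-! ### The transient probabilities of the `M/M/1` queue -/

/-- `exp ((lam + mu) * t)` times the transient probability of the `M/M/1` queue, as a function of
an integral initial state `k`. -/
def mm1Laurent (lam mu : ℝ) (k : ℤ) (n : ℕ) (t : ℝ) : ℝ :=
  expLaurent lam mu (n - k) t + (lam / mu) ^ n * (expLaurent lam mu (-(n + k + 1)) t +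
    (1 - lam / mu) * expLaurentTail lam mu (n + k + 2) t)

theorem mm1Prob_eq (hlam : 0 < lam) (hmu : 0 < mu) (k n : ℕ) (t : ℝ) :
    mm1Prob lam mu k n t = Real.exp (-(lam + mu) * t) * mm1Laurent lam mu k n t := by
  have h1 := rpow_mul_besselI hlam hmu ((n : ℤ) - k) t
  have h2 := rpow_mul_besselI hlam hmu ((n : ℤ) + k + 1) t
  have hr : 0 < lam / mu := div_pos hlam hmu
  have h3 : (lam / mu) ^ (((n : ℝ) - k - 1) / 2) * besselI ((n : ℤ) + k + 1)
      (2 * t * √(lam * mu)) = (lam / mu) ^ n * expLaurent lam mu (-(n + k + 1)) t := by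
    rw [expLaurent_reflect hlam hmu] at h2
    -- The reflection contributes the power n + k + 1 of λ/μ, and the shift by -(k + 1) leaves the
    -- power n.
    have e1 : ((n : ℝ) - k - 1) / 2 =
        (((n : ℤ) + k + 1 : ℤ) : ℝ) / 2 + ((-(k + 1) : ℤ) : ℝ) := by
      push_cast; ring
    rw [e1, Real.rpow_add hr, mul_right_comm, h2, Real.rpow_intCast, mul_right_comm,
      ← zpow_add₀ hr.ne', show (n : ℤ) + k + 1 + -(k + 1) = n by ring, zpow_natCast]
  rw [mm1Prob, h3]
  simp only [rpow_mul_besselI_natCast hlam hmu]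
  push_cast at h1 ⊢
  rw [h1, mm1Laurent, expLaurentTail]
  ring

theorem hasDerivAt_mm1Laurent (hlam : 0 ≤ lam) (hmu : 0 ≤ mu) (k : ℤ) (n : ℕ) (t : ℝ) :
    HasDerivAt (mm1Laurent lam mu k n)
      (lam * mm1Laurent lam mu (k + 1) n t + mu * mm1Laurent lam mu (k - 1) n t) t := by
  refine ((hasDerivAt_expLaurent hlam hmu (n - k) t).add
    (((hasDerivAt_expLaurent hlam hmu (-(n + k + 1)) t).add
    ((hasDerivAt_expLaurentTail hlam hmu (n + k + 2) t).const_mul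
      (1 - lam / mu))).const_mul ((lam / mu) ^ n))).congr_deriv ?_
  simp only [mm1Laurent]
  rw [show (n : ℤ) - (k + 1) = n - k - 1 by ring, show (n : ℤ) - (k - 1) = n - k + 1 by ring,
    show -((n : ℤ) + (k + 1) + 1) = -(n + k + 1) - 1 by ring,
    show -((n : ℤ) + (k - 1) + 1) = -(n + k + 1) + 1 by ring,
    show (n : ℤ) + (k + 1) + 2 = n + k + 2 + 1 by ring,
    show (n : ℤ) + (k - 1) + 2 = n + k + 2 - 1 by ring]
  ring

/-- The reflecting boundary condition. The image term alone misses it; the weight 1 - λ/μ on the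
tail, whose two values differ by one coefficient, repairs the defect. -/
theorem mm1Laurent_neg_one (hlam : 0 < lam) (hmu : 0 < mu) (n : ℕ) (t : ℝ) :
    mm1Laurent lam mu (-1) n t = mm1Laurent lam mu 0 n t := by
  have h1 := expLaurent_reflect hlam hmu (n : ℤ) t
  have h2 := expLaurent_reflect hlam hmu ((n : ℤ) + 1) t
  have h3 := expLaurentTail_eq_add hlam.le hmu.le ((n : ℤ) + 1) t
  rw [zpow_natCast] at h1
  rw [← Nat.cast_succ, zpow_natCast, pow_succ, Nat.cast_succ] at h2
  rw [mm1Laurent, mm1Laurent, sub_neg_eq_add, h2, sub_zero, h1,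
    show -((n : ℤ) + -1 + 1) = -n by ring, add_zero,
    show (n : ℤ) + -1 + 2 = n + 1 by ring, h3, add_assoc _ (1 : ℤ) 1, one_add_one_eq_two]
  ring

theorem mm1Laurent_zero_right (lam mu : ℝ) (k n : ℕ) :
    mm1Laurent lam mu k n 0 = if k = n then 1 else 0 := by
  rw [mm1Laurent, expLaurent_zero_right, expLaurent_zero_right,
    expLaurentTail_zero_right _ _ (by omega), if_neg (by omega : ¬-((n : ℤ) + k + 1) = 0)]
  have : ((n : ℤ) - k = 0) ↔ k = n := by omega
  simp [this]

/-- Uniformity in the initial state `k` is what the uniqueness argument needs. -/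
theorem exists_abs_mm1Laurent_le (hlam : 0 ≤ lam) (hmu : 0 ≤ mu) (n : ℕ) (T : ℝ) :
    ∃ M, ∀ k : ℕ, ∀ t, |t| ≤ T → |mm1Laurent lam mu k n t| ≤ M := by
  refine ⟨Real.exp (lam * T) * Real.exp (mu * T) + |(lam / mu) ^ n| *
    (Real.exp (lam * T) * Real.exp (mu * T) + |1 - lam / mu| * expLaurentTail lam mu 0 T), ?_⟩
  intro k t ht
  have hT : 0 ≤ T := (abs_nonneg t).trans ht
  have h1 : ∀ m, |expLaurent lam mu m t| ≤ Real.exp (lam * T) * Real.exp (mu * T) := fun m =>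
    (abs_expLaurent_le hlam hmu m ht).trans (expLaurent_le_exp hlam hmu m hT)
  have h2 : |expLaurentTail lam mu (n + k + 2) t| ≤ expLaurentTail lam mu 0 T :=
    (abs_expLaurentTail_le hlam hmu _ ht).trans
      (expLaurentTail_natCast_le hlam hmu (n + k + 2) hT)
  refine (abs_add_le _ _).trans (add_le_add (h1 _) ?_)
  rw [abs_mul]
  gcongr
  refine (abs_add_le _ _).trans (add_le_add (h1 _) ?_)
  rw [abs_mul]
  gcongr

/-- The image and tail depend on n + k only, and `expLaurent_reflect` handles the direct term. -/
theorem mm1Laurent_detailed_balance (hlam : 0 < lam) (hmu : 0 < mu) (k n : ℕ) (t : ℝ) :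
    (lam / mu) ^ k * mm1Laurent lam mu k n t = (lam / mu) ^ n * mm1Laurent lam mu n k t := by
  have hr : lam / mu ≠ 0 := (div_pos hlam hmu).ne'
  have h1 := expLaurent_reflect hlam hmu ((n : ℤ) - k) t
  rw [neg_sub, zpow_sub₀ hr, zpow_natCast, zpow_natCast] at h1
  rw [mm1Laurent, mm1Laurent, h1, add_comm (k : ℤ) n]
  field_simp

/-- The generator of the `M/M/1` queue; it reflects at zero since `0 - 1 = 0`. -/
def mm1Generator (lam mu : ℝ) (g : ℕ → ℝ) (k : ℕ) : ℝ :=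
  lam * (g (k + 1) - g k) + mu * (g (k - 1) - g k)

theorem abs_mm1Generator_le (hlam : 0 ≤ lam) (hmu : 0 ≤ mu) {g : ℕ → ℝ} {B : ℝ}
    (hB : ∀ k, |g k| ≤ B) (k : ℕ) : |mm1Generator lam mu g k| ≤ (2 * lam + 2 * mu) * B := by
  have h : ∀ a b, |g a - g b| ≤ 2 * B := fun a b => by
    have := (abs_sub (g a) (g b)).trans (add_le_add (hB a) (hB b))
    linarith
  calc |mm1Generator lam mu g k| ≤ lam * (2 * B) + mu * (2 * B) := by
        refine (abs_add_le _ _).trans (add_le_add ?_ ?_)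
        · rw [abs_mul, abs_of_nonneg hlam]
          gcongr
          exact h _ _
        · rw [abs_mul, abs_of_nonneg hmu]
          gcongr
          exact h _ _
    _ = _ := by ring

/-- Uniqueness for the queue killed at rate `c`; `c = 0` serves the plain queue, `c = eta .one`
environment 1. -/
theorem eq_zero_of_mm1Generator (hlam : 0 ≤ lam) (hmu : 0 ≤ mu) {c T M : ℝ} {u : ℕ → ℝ → ℝ}
    (hcont : ∀ k, Continuous (u k))
    (hderiv : ∀ k t, 0 ≤ t → HasDerivWithinAt (u k)
      (mm1Generator lam mu (fun l => u l t) k - c * u k t) (Set.Ici t) t)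
    (hM : ∀ k, ∀ t ∈ Set.Icc 0 T, |u k t| ≤ M) (hzero : ∀ k, u k 0 = 0) (k : ℕ) {t : ℝ}
    (ht : t ∈ Set.Icc 0 T) : u k t = 0 := by
  refine eq_zero_of_forall_hasDerivWithinAt (C := 2 * lam + 2 * mu + |c|)
    (fun k => (hcont k).continuousOn) (fun k t ht => hderiv k t ht.1) ?_ hM hzero k ht
  intro k t _ B hB
  refine (abs_sub _ _).trans ?_
  rw [add_mul, abs_mul]
  exact add_le_add (abs_mm1Generator_le hlam hmu hB k)
    (mul_le_mul_of_nonneg_left (hB k) (abs_nonneg c))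

theorem hasDerivAt_mm1Prob (hlam : 0 < lam) (hmu : 0 < mu) (k n : ℕ) (t : ℝ) :
    HasDerivAt (mm1Prob lam mu k n)
      (mm1Generator lam mu (fun l => mm1Prob lam mu l n t) k) t := by
  rw [show mm1Prob lam mu k n = fun t => _ from funext (mm1Prob_eq hlam hmu k n)]
  have h1 : HasDerivAt (fun t : ℝ => Real.exp (-(lam + mu) * t))
      (Real.exp (-(lam + mu) * t) * -(lam + mu)) t := by
    simpa using ((hasDerivAt_id t).const_mul (-(lam + mu))).exp
  refine (h1.mul (hasDerivAt_mm1Laurent hlam.le hmu.le k n t)).congr_deriv ?_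
  -- At k = 0 the integer index -1 and the truncated index 0 agree by the boundary condition.
  have h2 : mm1Laurent lam mu ((k : ℤ) - 1) n t = mm1Laurent lam mu (k - 1 : ℕ) n t := by
    cases k with
    | zero => simpa using mm1Laurent_neg_one hlam hmu n t
    | succ k => simp
  simp only [mm1Generator, mm1Prob_eq hlam hmu]
  rw [h2]
  push_cast
  ring

theorem continuous_mm1Prob (hlam : 0 < lam) (hmu : 0 < mu) (k n : ℕ) :
    Continuous (mm1Prob lam mu k n) :=
  continuous_iff_continuousAt.mpr fun t => (hasDerivAt_mm1Prob hlam hmu k n t).continuousAt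

theorem mm1Prob_zero_right (hlam : 0 < lam) (hmu : 0 < mu) (k n : ℕ) :
    mm1Prob lam mu k n 0 = if k = n then 1 else 0 := by
  rw [mm1Prob_eq hlam hmu, mm1Laurent_zero_right, mul_zero, Real.exp_zero, one_mul]

theorem exists_abs_mm1Prob_le (hlam : 0 < lam) (hmu : 0 < mu) (n : ℕ) (T : ℝ) :
    ∃ M, ∀ k : ℕ, ∀ t ∈ Set.Icc 0 T, |mm1Prob lam mu k n t| ≤ M := by
  obtain ⟨M, hM⟩ := exists_abs_mm1Laurent_le hlam.le hmu.le n T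
  refine ⟨M, fun k t ht => ?_⟩
  rw [mm1Prob_eq hlam hmu, abs_mul, Real.abs_exp]
  have h1 : Real.exp (-(lam + mu) * t) ≤ 1 :=
    Real.exp_le_one_iff.mpr (by nlinarith [ht.1, mul_nonneg (add_pos hlam hmu).le ht.1])
  have h2 := hM k t (by rw [abs_of_nonneg ht.1]; exact ht.2)
  exact (mul_le_of_le_one_left (abs_nonneg _) h1).trans h2

theorem mm1Prob_detailed_balance (hlam : 0 < lam) (hmu : 0 < mu) (k n : ℕ) (t : ℝ) :
    (lam / mu) ^ k * mm1Prob lam mu k n t = (lam / mu) ^ n * mm1Prob lam mu n k t := by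
  rw [mm1Prob_eq hlam hmu, mm1Prob_eq hlam hmu, mul_left_comm,
    mm1Laurent_detailed_balance hlam hmu, mul_left_comm]

/-- The net probability flux from `n` to `n + 1` for the `M/M/1` queue started in `k`. -/
def mm1Flux (lam mu : ℝ) (k n : ℕ) (t : ℝ) : ℝ :=
  lam * mm1Prob lam mu k n t - mu * mm1Prob lam mu k (n + 1) t

/-- Detailed balance turns the backward equation into the forward one. The flux form makes sums over
`n` telescope. -/
theorem hasDerivAt_mm1Prob_forward (hlam : 0 < lam) (hmu : 0 < mu) (k n : ℕ) (t : ℝ) :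
    HasDerivAt (mm1Prob lam mu k n)
      ((if n = 0 then 0 else mm1Flux lam mu k (n - 1) t) - mm1Flux lam mu k n t) t := by
  have hr : lam / mu ≠ 0 := (div_pos hlam hmu).ne'
  have hb : ∀ m s, mm1Prob lam mu k m s = (lam / mu) ^ m / (lam / mu) ^ k * mm1Prob lam mu m k s :=
    fun m s => by
      rw [div_mul_eq_mul_div, ← mm1Prob_detailed_balance hlam hmu]
      field_simp
  rw [show mm1Prob lam mu k n = fun s => _ from funext (hb n)]
  refine ((hasDerivAt_mm1Prob hlam hmu n k t).const_mul _).congr_deriv ?_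
  simp only [mm1Generator, mm1Flux, hb]
  cases n with
  | zero =>
    simp only [pow_succ, pow_zero, if_true]
    field_simp
    ring
  | succ n =>
    simp only [pow_succ, Nat.succ_ne_zero, if_false, Nat.add_sub_cancel]
    field_simp
    ring

/-! ### The transient probabilities from the state zero -/

theorem hasSum_mul_expLaurent (hlam : 0 ≤ lam) (hmu : 0 ≤ mu) (n : ℕ) (t : ℝ) :
    HasSum (fun l : ℕ => ((n + 1 + l : ℕ) : ℝ) * expLaurent lam mu (-((n + 1 + l : ℕ) : ℤ)) t)
      (mu * t * expLaurentTail lam mu n t - lam * t * expLaurentTail lam mu (n + 2) t) := by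
  refine (((summable_expLaurent_neg_add hlam hmu n t).hasSum.mul_left (mu * t)).sub
    ((summable_expLaurent_neg_add hlam hmu (n + 2) t).hasSum.mul_left (lam * t))).congr_fun
    fun l => ?_
  have h := mul_expLaurent hlam hmu (-((n + 1 + l : ℕ) : ℤ)) t
  rw [show -((n + 1 + l : ℕ) : ℤ) - 1 = -(n + 2 + l) by push_cast; ring,
    show -((n + 1 + l : ℕ) : ℤ) + 1 = -(n + l) by push_cast; ring] at h
  rw [Int.cast_neg, Int.cast_natCast] at h
  linarith

/-- For k = 0 all three terms of the formula merge into two tails. -/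
theorem mm1Prob_zero_left (hlam : 0 < lam) (hmu : 0 < mu) (n : ℕ) (t : ℝ) :
    mu * t * mm1Prob lam mu 0 n t = (lam / mu) ^ n * Real.exp (-(lam + mu) * t) *
      (mu * t * expLaurentTail lam mu n t - lam * t * expLaurentTail lam mu (n + 2) t) := by
  have h1 := expLaurent_reflect hlam hmu (n : ℤ) t
  rw [zpow_natCast] at h1
  rw [mm1Prob_eq hlam hmu, mm1Laurent, Nat.cast_zero, sub_zero, h1,
    expLaurentTail_eq_add hlam.le hmu.le n, expLaurentTail_eq_add hlam.le hmu.le (n + 1),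
    add_zero, add_assoc _ (1 : ℤ) 1, one_add_one_eq_two]
  field_simp
  ring

end

/-! ### Uniqueness for the `M/M/1` queue -/

/-- The states that the `M/M/1` queue can jump to from `k`. -/
def mm1Neighbors (k : ℕ) : Finset ℕ := ({k + 1, k - 1} : Finset ℕ).erase k

theorem notMem_mm1Neighbors (k : ℕ) : k ∉ mm1Neighbors k := Finset.notMem_erase _ _

theorem mm1Rate_eq_zero (lam mu : ℝ) {k m : ℕ} (h : m ≠ k) (hm : m ∉ mm1Neighbors k) :
    mm1Rate lam mu k m = 0 := by
  simp only [mm1Neighbors, Finset.mem_erase, Finset.mem_insert, Finset.mem_singleton] at hm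
  have hm := not_and.mp hm h
  rw [mm1Rate, if_neg (by omega), if_neg (by omega)]

theorem mm1Rate_nonneg {lam mu : ℝ} (hlam : 0 ≤ lam) (hmu : 0 ≤ mu) (k m : ℕ) :
    0 ≤ mm1Rate lam mu k m := by
  rw [mm1Rate]
  split_ifs <;> first | assumption | rfl

theorem sum_mm1Rate_mul (lam mu : ℝ) (g : ℕ → ℝ) (k : ℕ) :
    ∑ m ∈ mm1Neighbors k, mm1Rate lam mu k m * (g m - g k) = mm1Generator lam mu g k := by
  -- The term m = k is zero, so it can be restored; for k = 0 it coincides with k - 1.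
  rw [mm1Neighbors, Finset.sum_erase _ (by simp), Finset.sum_pair (by omega), mm1Generator]
  congr 1
  · simp [mm1Rate]
  · cases k with
    | zero => simp
    | succ k =>
      simp only [mm1Rate, Nat.add_sub_cancel]
      rw [if_neg (by omega), if_pos trivial]

theorem IsTransitionFunction.eq_mm1Prob {lam mu : ℝ} (hlam : 0 < lam) (hmu : 0 < mu)
    {P : ℝ≥0 → ℕ → ℕ → ℝ} (hP : IsTransitionFunction P)
    (hQ : HasQMatrix P (qMatrix (mm1Rate lam mu))) (t : ℝ≥0) (k n : ℕ) :
    P t k n = mm1Prob lam mu k n t := by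
  obtain ⟨M, hM⟩ := exists_abs_mm1Prob_le hlam hmu n t
  have h := eq_zero_of_mm1Generator (c := 0) (T := t) (M := 1 + M) hlam.le hmu.le
    (u := fun k s => P s.toNNReal k n - mm1Prob lam mu k n s)
    (fun k => (hP.continuous_toNNReal hQ k n).sub (continuous_mm1Prob hlam hmu k n))
    ?_ ?_ ?_ k (t := t) ⟨t.2, le_rfl⟩
  · simpa [sub_eq_zero] using h
  · intro k s hs
    have h1 := hP.hasDerivWithinAt_backward hQ (notMem_mm1Neighbors k)
      (fun z => mm1Rate_eq_zero lam mu) n hs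
    rw [sum_mm1Rate_mul lam mu fun k => P s.toNNReal k n] at h1
    refine (h1.sub (hasDerivAt_mm1Prob hlam hmu k n s).hasDerivWithinAt).congr_deriv ?_
    simp only [mm1Generator]
    ring
  · intro k s hs
    refine (abs_sub _ _).trans (add_le_add ?_ (hM k s hs))
    rw [abs_of_nonneg (hP.nonneg _ _ _)]
    exact hP.le_one _ _ _
  · intro k
    simp [hP.zero, mm1Prob_zero_right hlam hmu]

/-! ### The queue with one switching of the environment -/

section Switching

variable {lam mu eta : Env → ℝ} {P : ℝ≥0 → ℕ × Env → ℕ × Env → ℝ}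

/-- The states that the queue in a switching environment can jump to from `(k, .one)`. -/
def switchingNeighbors (k : ℕ) : Finset (ℕ × Env) :=
  insert (k, .two) (mm1Neighbors k ×ˢ {.one})

theorem notMem_switchingNeighbors (k : ℕ) : (k, Env.one) ∉ switchingNeighbors k := by
  simp [switchingNeighbors, notMem_mm1Neighbors]

theorem switchingRate_eq_zero (k : ℕ) (z : ℕ × Env) (h : z ≠ (k, .one))
    (hz : z ∉ switchingNeighbors k) : switchingRate lam mu eta (k, .one) z = 0 := by
  obtain ⟨m, i⟩ := z
  cases i with
  | one =>
    simp only [switchingRate, if_true]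
    exact mm1Rate_eq_zero _ _ (by simpa using h) (by simpa [switchingNeighbors] using hz)
  | two =>
    have : m ≠ k := by simpa [switchingNeighbors] using hz
    simp [switchingRate, this]

theorem switchingRate_nonneg (hlam : ∀ i, 0 < lam i) (hmu : ∀ i, 0 < mu i)
    (heta : ∀ i, 0 ≤ eta i) (x y : ℕ × Env) : 0 ≤ switchingRate lam mu eta x y := by
  rw [switchingRate]
  split_ifs
  · exact mm1Rate_nonneg (hlam _).le (hmu _).le _ _
  · exact heta _
  · rfl

theorem switchingRate_two_eq_zero (heta : eta .two = 0) (k : ℕ) (z : ℕ × Env)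
    (h : z ≠ (k, .two)) (hz : z ∉ mm1Neighbors k ×ˢ {Env.two}) :
    switchingRate lam mu eta (k, .two) z = 0 := by
  obtain ⟨m, i⟩ := z
  cases i with
  | one => simp [switchingRate, heta]
  | two =>
    simp only [switchingRate, if_true]
    exact mm1Rate_eq_zero _ _ (by simpa using h) (by simpa using hz)

theorem sum_switchingRate_mul (g : ℕ × Env → ℝ) (k : ℕ) :
    ∑ z ∈ switchingNeighbors k, switchingRate lam mu eta (k, .one) z * (g z - g (k, .one)) =
      mm1Generator (lam .one) (mu .one) (fun l => g (l, .one)) k +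
        eta .one * (g (k, .two) - g (k, .one)) := by
  rw [switchingNeighbors, Finset.sum_insert (by simp), Finset.sum_product, add_comm,
    ← sum_mm1Rate_mul]
  simp [switchingRate]

theorem sum_switchingRate_two_mul (g : ℕ × Env → ℝ) (k : ℕ) :
    ∑ z ∈ mm1Neighbors k ×ˢ {Env.two},
      switchingRate lam mu eta (k, .two) z * (g z - g (k, .two)) =
      mm1Generator (lam .two) (mu .two) (fun l => g (l, .two)) k := by
  rw [Finset.sum_product, ← sum_mm1Rate_mul]
  simp [switchingRate]

variable (hlam : ∀ i, 0 < lam i) (hmu : ∀ i, 0 < mu i) (heta : eta .two = 0)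
  (hP : IsTransitionFunction P) (hQ : HasQMatrix P (qMatrix (switchingRate lam mu eta)))

include hlam hmu heta hP hQ

/-- Within environment 2 the backward system is closed, and here its initial data are zero. -/
theorem two_one_eq_zero (t : ℝ≥0) (k n : ℕ) : P t (k, .two) (n, .one) = 0 := by
  have h := eq_zero_of_mm1Generator (c := 0) (T := t) (M := 1) (hlam .two).le (hmu .two).le
    (u := fun k s => P s.toNNReal (k, .two) (n, .one))
    (fun k => hP.continuous_toNNReal hQ _ _) ?_ ?_ ?_ k (t := t) ⟨t.2, le_rfl⟩
  · simpa using h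
  · intro k s hs
    have h1 := hP.hasDerivWithinAt_backward hQ (by simp [notMem_mm1Neighbors])
      (switchingRate_two_eq_zero heta k) (n, .one) hs
    rw [sum_switchingRate_two_mul fun z => P s.toNNReal z (n, .one)] at h1
    simpa using h1
  · intro k s _
    rw [abs_of_nonneg (hP.nonneg _ _ _)]
    exact hP.le_one _ _ _
  · intro k
    simp [hP.zero]

theorem two_two_eq_mm1Prob (t : ℝ≥0) (k n : ℕ) :
    P t (k, .two) (n, .two) = mm1Prob (lam .two) (mu .two) k n t := by
  obtain ⟨M, hM⟩ := exists_abs_mm1Prob_le (hlam .two) (hmu .two) n t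
  have h := eq_zero_of_mm1Generator (c := 0) (T := t) (M := 1 + M) (hlam .two).le (hmu .two).le
    (u := fun k s => P s.toNNReal (k, .two) (n, .two) - mm1Prob (lam .two) (mu .two) k n s)
    (fun k => (hP.continuous_toNNReal hQ _ _).sub (continuous_mm1Prob (hlam _) (hmu _) k n))
    ?_ ?_ ?_ k (t := t) ⟨t.2, le_rfl⟩
  · simpa [sub_eq_zero] using h
  · intro k s hs
    have h1 := hP.hasDerivWithinAt_backward hQ (by simp [notMem_mm1Neighbors])
      (switchingRate_two_eq_zero heta k) (n, .two) hs
    rw [sum_switchingRate_two_mul fun z => P s.toNNReal z (n, .two)] at h1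
    refine (h1.sub (hasDerivAt_mm1Prob (hlam _) (hmu _) k n s).hasDerivWithinAt).congr_deriv ?_
    simp only [mm1Generator]
    ring
  · intro k s hs
    refine (abs_sub _ _).trans (add_le_add ?_ (hM k s hs))
    rw [abs_of_nonneg (hP.nonneg _ _ _)]
    exact hP.le_one _ _ _
  · intro k
    simp [hP.zero, mm1Prob_zero_right (hlam .two) (hmu .two)]

/-- There is no return from environment 2, so the switching term of the backward equation reduces to
killing at rate `eta .one`. -/
theorem one_one_eq_exp_mul_mm1Prob (heta' : 0 ≤ eta .one) (t : ℝ≥0) (k n : ℕ) :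
    P t (k, .one) (n, .one) =
      Real.exp (-eta .one * t) * mm1Prob (lam .one) (mu .one) k n t := by
  obtain ⟨M, hM⟩ := exists_abs_mm1Prob_le (hlam .one) (hmu .one) n t
  have hexp : ∀ s : ℝ, HasDerivAt (fun s : ℝ => Real.exp (-eta .one * s))
      (Real.exp (-eta .one * s) * -eta .one) s := fun s => by
    simpa using ((hasDerivAt_id s).const_mul (-eta .one)).exp
  have h := eq_zero_of_mm1Generator (c := eta .one) (T := t) (M := 1 + M)
    (hlam .one).le (hmu .one).le
    (u := fun k s => P s.toNNReal (k, .one) (n, .one) -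
      Real.exp (-eta .one * s) * mm1Prob (lam .one) (mu .one) k n s)
    (fun k => (hP.continuous_toNNReal hQ _ _).sub
      ((by fun_prop : Continuous fun s : ℝ => Real.exp (-eta .one * s)).mul
        (continuous_mm1Prob (hlam _) (hmu _) k n)))
    ?_ ?_ ?_ k (t := t) ⟨t.2, le_rfl⟩
  · simpa [sub_eq_zero] using h
  · intro k s hs
    have h1 := hP.hasDerivWithinAt_backward hQ (notMem_switchingNeighbors k)
      (switchingRate_eq_zero k) (n, .one) hs
    rw [sum_switchingRate_mul fun z => P s.toNNReal z (n, .one),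
      two_one_eq_zero hlam hmu heta hP hQ] at h1
    refine (h1.sub ((hexp s).mul
      (hasDerivAt_mm1Prob (hlam _) (hmu _) k n s)).hasDerivWithinAt).congr_deriv ?_
    simp only [mm1Generator]
    ring
  · intro k s hs
    refine (abs_sub _ _).trans (add_le_add ?_ ?_)
    · rw [abs_of_nonneg (hP.nonneg _ _ _)]
      exact hP.le_one _ _ _
    · rw [abs_mul, Real.abs_exp]
      have h1 : Real.exp (-eta .one * s) ≤ 1 :=
        Real.exp_le_one_iff.mpr (by nlinarith [mul_nonneg heta' hs.1])
      exact (mul_le_of_le_one_left (abs_nonneg _) h1).trans (hM k s hs)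
  · intro k
    simp [hP.zero, mm1Prob_zero_right (hlam .one) (hmu .one)]

end Switching

/-! ### The passage from environment 1 to environment 2 -/

section Switching

variable {lam mu eta : Env → ℝ} {P : ℝ≥0 → ℕ × Env → ℕ × Env → ℝ}

theorem sum_range_sub_flux_telescope (D W : ℕ → ℝ) (L : ℕ) :
    ∑ l ∈ Finset.range (L + 1), ((if l = 0 then 0 else D (l - 1)) - D l - W l) =
      -D L - ∑ l ∈ Finset.range (L + 1), W l := by
  rw [Finset.sum_sub_distrib]
  congr 1
  induction L with
  | zero => simp
  | succ L ih =>
    rw [Finset.sum_range_succ, ih]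
    simp only [Nat.succ_ne_zero, if_false, Nat.add_sub_cancel]
    ring

/-- The probability of a switching path from `(j, .one)` to `(n, .two)`: the environment switches
at time `τ` while there are `k` customers. -/
theorem hasSum_integral_one_two (hlam : ∀ i, 0 < lam i) (hmu : ∀ i, 0 < mu i)
    (heta : ∀ i, 0 ≤ eta i) (heta_two : eta .two = 0)
    (hP : IsTransitionFunction P) (hQ : HasQMatrix P (qMatrix (switchingRate lam mu eta)))
    (heta_one : 0 < eta .one) (t : ℝ≥0) (j n : ℕ) :
    HasSum (fun k : ℕ => ∫ τ in (0 : ℝ)..t, Real.exp (-eta .one * τ) *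
        mm1Prob (lam .one) (mu .one) j k τ * mm1Prob (lam .two) (mu .two) k n (t - τ))
      (P t (j, .one) (n, .two) / eta .one) := by
  set R : ℕ → ℝ → ℝ := fun k τ => Real.exp (-eta .one * τ) * mm1Prob (lam .one) (mu .one) j k τ
    with hR
  set v : ℕ → ℝ → ℝ := fun k s => P s.toNNReal (k, .one) (n, .two) with hv
  set w : ℕ → ℝ → ℝ := fun k s => mm1Prob (lam .two) (mu .two) k n s with hw
  have hvt : v j t = P t (j, .one) (n, .two) := by simp only [hv, Real.toNNReal_coe]
  have ht0 : (0 : ℝ) ≤ t := t.2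
  rw [← hvt]
  change HasSum (fun k : ℕ => ∫ τ in (0 : ℝ)..t, R k τ * w k (t - τ)) _
  have hexp : ∀ s : ℝ, HasDerivAt (fun s : ℝ => Real.exp (-eta .one * s))
      (Real.exp (-eta .one * s) * -eta .one) s := fun s => by
    simpa using ((hasDerivAt_id s).const_mul (-eta .one)).exp
  have hRc : ∀ k, Continuous (R k) := fun k =>
    (by fun_prop : Continuous fun s : ℝ => Real.exp (-eta .one * s)).mul
      (continuous_mm1Prob (hlam _) (hmu _) j k)
  have hvc : ∀ k, Continuous (v k) := fun k => hP.continuous_toNNReal hQ _ _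
  have hwc : ∀ k, Continuous (w k) := fun k => continuous_mm1Prob (hlam _) (hmu _) k n
  have hsub : Continuous fun τ : ℝ => (t : ℝ) - τ := by fun_prop
  have hRP : ∀ k τ, 0 ≤ τ → R k τ = P τ.toNNReal (j, .one) (k, .one) := fun k τ hτ => by
    rw [one_one_eq_exp_mul_mm1Prob hlam hmu heta_two hP hQ heta_one.le, Real.coe_toNNReal _ hτ]
  have hwP : ∀ k s, 0 ≤ s → w k s = P s.toNNReal (k, .two) (n, .two) := fun k s hs => by
    rw [two_two_eq_mm1Prob hlam hmu heta_two hP hQ, Real.coe_toNNReal _ hs]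
  have hR0 : ∀ k τ, 0 ≤ τ → 0 ≤ R k τ := fun k τ hτ => by
    rw [hRP k τ hτ]; exact hP.nonneg _ _ _
  have hw0 : ∀ k s, 0 ≤ s → 0 ≤ w k s := fun k s hs => by
    rw [hwP k s hs]; exact hP.nonneg _ _ _
  have hRd : ∀ k τ, HasDerivAt (R k) (((if k = 0 then 0 else
      lam .one * R (k - 1) τ - mu .one * R (k - 1 + 1) τ) -
      (lam .one * R k τ - mu .one * R (k + 1) τ)) - eta .one * R k τ) τ := fun k τ => by
    refine ((hexp τ).mul (hasDerivAt_mm1Prob_forward (hlam .one) (hmu .one) j k τ)).congr_deriv ?_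
    simp only [hR, mm1Flux]
    split_ifs <;> ring
  have hvd : ∀ k s, 0 < s → HasDerivAt (v k)
      (mm1Generator (lam .one) (mu .one) (fun l => v l s) k + eta .one * (w k s - v k s)) s :=
    fun k s hs => by
      have h1 := hP.hasDerivAt_backward hQ (notMem_switchingNeighbors k)
        (switchingRate_eq_zero k) (n, .two) hs
      rw [sum_switchingRate_mul fun z => P s.toNNReal z (n, .two)] at h1
      rw [hwP k s hs.le]
      exact h1
  -- The flux of the pairing of `R` and `v` between levels l and l + 1, left over when the sum is
  -- cut off at l.
  set D : ℕ → ℝ → ℝ := fun l τ =>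
    lam .one * R l τ * v (l + 1) (t - τ) - mu .one * R (l + 1) τ * v l (t - τ) with hD
  have hDc : ∀ l, Continuous (D l) := fun l =>
    ((continuous_const.mul (hRc l)).mul ((hvc _).comp hsub)).sub
      ((continuous_const.mul (hRc _)).mul ((hvc _).comp hsub))
  have hRwc : ∀ l, Continuous fun τ : ℝ => R l τ * w l (t - τ) := fun l =>
    (hRc l).mul ((hwc l).comp hsub)
  -- The truncated pairing equals `v j t` at τ = 0, since j ≤ L, and 0 at τ = t. Forward and
  -- backward terms cancel except for the flux at `L` and the source `eta .one * w` in the equation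
  -- of `v`.
  have hstep : ∀ L, j ≤ L → v j t / eta .one -
      ∑ l ∈ Finset.range (L + 1), ∫ τ in (0 : ℝ)..t, R l τ * w l (t - τ) =
      (∫ τ in (0 : ℝ)..t, D L τ) / eta .one := by
    intro L hL
    have hFTC := intervalIntegral.integral_eq_sub_of_hasDerivAt_of_le (a := 0) (b := (t : ℝ)) ht0
      (f := fun τ => ∑ l ∈ Finset.range (L + 1), R l τ * v l (t - τ))
      (f' := fun τ => -D L τ - ∑ l ∈ Finset.range (L + 1), eta .one * (R l τ * w l (t - τ)))
      (continuous_finsetSum _ fun l _ => (hRc l).mul ((hvc l).comp hsub)).continuousOn ?_ ?_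
    · rw [intervalIntegral.integral_sub, intervalIntegral.integral_neg,
        intervalIntegral.integral_finsetSum] at hFTC
      · simp only [intervalIntegral.integral_const_mul] at hFTC
        rw [← Finset.mul_sum] at hFTC
        have h1 : ∑ l ∈ Finset.range (L + 1), R l t * v l (t - t) = 0 :=
          Finset.sum_eq_zero fun l _ => by simp [hv, hP.zero]
        have h2 : ∑ l ∈ Finset.range (L + 1), R l 0 * v l (t - 0) = v j t := by
          rw [Finset.sum_eq_single j]
          · simp [hR, mm1Prob_zero_right (hlam .one) (hmu .one)]
          · intro l _ hl
            simp [hR, mm1Prob_zero_right (hlam .one) (hmu .one), hl.symm]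
          · intro h
            exact absurd (Finset.mem_range.mpr (by omega)) h
        rw [h1, h2] at hFTC
        field_simp
        linarith
      · exact fun l _ => (continuous_const.mul (hRwc l)).intervalIntegrable _ _
      · exact (hDc L).neg.intervalIntegrable _ _
      · exact (continuous_finsetSum _ fun l _ =>
          continuous_const.mul (hRwc l)).intervalIntegrable _ _
    · intro τ hτ
      have hvτ : ∀ l, HasDerivAt (fun τ : ℝ => v l (t - τ)) _ τ := fun l =>
        (hvd l (t - τ) (sub_pos.mpr hτ.2)).comp_const_sub (t : ℝ) τ
      have hsum := HasDerivAt.fun_sum (u := Finset.range (L + 1)) fun l _ => (hRd l τ).mul (hvτ l)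
      refine hsum.congr_deriv ?_
      rw [← sum_range_sub_flux_telescope (fun l => D l τ)]
      refine Finset.sum_congr rfl fun l _ => ?_
      simp only [hD, mm1Generator]
      cases l with
      | zero => simp only [if_true, zero_add, Nat.zero_sub]; ring
      | succ l => simp only [Nat.succ_ne_zero, if_false, Nat.add_sub_cancel]; ring
    · exact ((hDc L).neg.sub (continuous_finsetSum _ fun l _ =>
        continuous_const.mul (hRwc l))).intervalIntegrable _ _
  -- K = exp(qt), with q the total rate out of (j, 1), does not depend on k. So decay of `R k` at
  -- the single time t gives decay uniform on [0, t].
  obtain ⟨K, hK⟩ : ∃ K, ∀ k, ∀ τ : ℝ, 0 ≤ τ → τ ≤ t → R k τ ≤ K * R k t := by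
    set q := ∑ z ∈ switchingNeighbors j, switchingRate lam mu eta (j, .one) z with hq
    have hq0 : 0 ≤ q := Finset.sum_nonneg fun z _ => switchingRate_nonneg hlam hmu heta _ _
    refine ⟨Real.exp (q * t), fun k τ h0 ht => ?_⟩
    have h1 := hP.exp_mul_le_exp_mul hQ (notMem_switchingNeighbors j) (switchingRate_eq_zero j)
      (switchingRate_nonneg hlam hmu heta _) (k, .one) h0 ht
    rw [← hRP k τ h0, ← hRP k t ht0] at h1
    refine le_trans ?_ h1
    exact le_mul_of_one_le_left (hR0 k τ h0) (Real.one_le_exp (mul_nonneg hq0 h0))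
  -- These are probabilities of distinct states, hence summable.
  have hRt : Tendsto (fun l => R l t) atTop (𝓝 0) := by
    have h1 : Summable fun k : ℕ => P t (j, .one) (k, .one) :=
      (hP.hasSum_one t (j, .one)).summable.comp_injective
        (i := fun k : ℕ => ((k, .one) : ℕ × Env)) fun a b h => (Prod.mk.inj h).1
    refine h1.tendsto_atTop_zero.congr fun k => ?_
    rw [hRP k t ht0, Real.toNNReal_coe]
  have hDlim : Tendsto (fun L => ∫ τ in (0 : ℝ)..t, D L τ) atTop (𝓝 0) := by
    have hb : Tendsto (fun L => (lam .one * (K * R L t) + mu .one * (K * R (L + 1) t)) *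
        |(t : ℝ) - 0|) atTop (𝓝 0) := by
      simpa using (((hRt.const_mul K).const_mul (lam .one)).add
        (((hRt.comp (tendsto_add_atTop_nat 1)).const_mul K).const_mul (mu .one))).mul_const
        |(t : ℝ) - 0|
    refine squeeze_zero_norm (fun L => ?_) hb
    refine intervalIntegral.norm_integral_le_of_norm_le_const fun τ hτ => ?_
    rw [Set.uIoc_of_le ht0] at hτ
    have hvb : ∀ l, |v l (t - τ)| ≤ 1 := fun l => by
      rw [abs_of_nonneg (hP.nonneg _ _ _)]
      exact hP.le_one _ _ _
    have hterm : ∀ a, 0 < a → ∀ k l, |a * R k τ * v l (t - τ)| ≤ a * (K * R k t) := by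
      intro a ha k l
      rw [abs_mul, abs_mul, abs_of_pos ha, abs_of_nonneg (hR0 k τ hτ.1.le)]
      calc a * R k τ * |v l (t - τ)| ≤ a * R k τ * 1 := by
            gcongr
            · exact mul_nonneg ha.le (hR0 k τ hτ.1.le)
            · exact hvb l
        _ ≤ _ := by
            rw [mul_one]
            gcongr
            exact hK k τ hτ.1.le hτ.2
    exact (abs_sub _ _).trans (add_le_add (hterm _ (hlam _) _ _) (hterm _ (hmu _) _ _))
  rw [hasSum_iff_tendsto_nat_of_nonneg, ← tendsto_add_atTop_iff_nat 1]
  · have h1 := (hDlim.div_const (eta .one)).const_sub (v j t / eta .one)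
    rw [zero_div, sub_zero] at h1
    refine h1.congr' ?_
    filter_upwards [eventually_ge_atTop j] with L hL
    rw [← hstep L hL]
    ring
  · intro k
    exact intervalIntegral.integral_nonneg ht0 fun τ hτ =>
      mul_nonneg (hR0 k τ hτ.1) (hw0 k _ (sub_nonneg.mpr hτ.2))

end Switching

/-- The law of a Markov chain at time `t` whose initial state is one of two states. -/
theorem IsMarkovChainWith.real_eq_of_two_initial_states {S Ω : Type*} [DecidableEq S]
    [MeasurableSpace Ω] {ℙ : Measure Ω} [IsProbabilityMeasure ℙ] {X : ℝ≥0 → Ω → S}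
    {P : ℝ≥0 → S → S → ℝ} (hX : IsMarkovChainWith ℙ X P) {a b : S} (hab : a ≠ b) {p : ℝ}
    (ha : ℙ.real {ω | X 0 ω = a} = p) (hb : ℙ.real {ω | X 0 ω = b} = 1 - p) (t : ℝ≥0) (y : S) :
    ℙ.real {ω | X t ω = y} = p * P t a y + (1 - p) * P t b y := by
  have hm : ∀ x, ℙ.real ({ω | X 0 ω = x} ∩ {ω | X t ω = y}) =
      ℙ.real {ω | X 0 ω = x} * P t x y := fun x => by
    simpa using hX.markov 0 t x y Set.univ MeasurableSet.univ
  have hdisj : Disjoint {ω | X 0 ω = a} {ω | X 0 ω = b} :=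
    Set.disjoint_left.mpr fun ω h1 h2 => hab (h1.symm.trans h2)
  have hA := hX.measurableSet 0 a
  have hB := hX.measurableSet 0 b
  have hY := hX.measurableSet t y
  -- The two initial states carry all the mass, so other starting points contribute a null set.
  have hfull : ℙ.real ({ω | X 0 ω = a} ∪ {ω | X 0 ω = b}) = 1 := by
    rw [measureReal_union hdisj hB, ha, hb]
    ring
  have hnull : ℙ.real ({ω | X t ω = y} \ ({ω | X 0 ω = a} ∪ {ω | X 0 ω = b})) = 0 := by
    refine le_antisymm ?_ measureReal_nonneg
    have h1 := probReal_compl_eq_one_sub (μ := ℙ) (hA.union hB)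
    rw [hfull, sub_self] at h1
    rw [← h1]
    exact measureReal_mono (Set.sdiff_subset_compl _ _)
  rw [← measureReal_inter_add_sdiff (s := {ω | X t ω = y}) (hA.union hB), hnull, add_zero,
    Set.inter_comm, Set.union_inter_distrib_right, measureReal_union _ (hB.inter hY), hm, hm, ha,
    hb]
  exact hdisj.mono Set.inter_subset_left Set.inter_subset_left

end

theorem proposition2 {Ω : Type*} [MeasurableSpace Ω] (ℙ : Measure Ω) [IsProbabilityMeasure ℙ]
    (lam mu eta : Env → ℝ) (hlam : ∀ i, 0 < lam i) (hmu : ∀ i, 0 < mu i)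
    (heta : ∀ i, 0 ≤ eta i) (heta_pos : 0 < eta .one + eta .two) (heta_two : eta .two = 0)
    (p : ℝ) (hp : p ∈ Set.Icc (0 : ℝ) 1) (j : ℕ)
    (N : ℝ≥0 → Ω → ℕ × Env) (hN : IsMarkovChain ℙ N (switchingRate lam mu eta))
    (hN_one : ℙ.real {ω | N 0 ω = (j, .one)} = p)
    (hN_two : ℙ.real {ω | N 0 ω = (j, .two)} = 1 - p) :
    -- the state probabilities in environment 1
    (∀ (t : ℝ≥0) (n : ℕ), ℙ.real {ω | N t ω = (n, .one)} =
      p * Real.exp (-eta .one * t) * mm1Prob (lam .one) (mu .one) j n t) ∧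
    -- the state probabilities in environment 2; the integrals and their series converge
    (∀ (t : ℝ≥0) (n : ℕ),
      (∀ k : ℕ, IntervalIntegrable (fun τ : ℝ => Real.exp (-eta .one * τ) *
        mm1Prob (lam .one) (mu .one) j k τ * mm1Prob (lam .two) (mu .two) k n (t - τ))
        volume 0 t) ∧
      Summable (fun k : ℕ => ∫ τ in (0 : ℝ)..t, Real.exp (-eta .one * τ) *
        mm1Prob (lam .one) (mu .one) j k τ * mm1Prob (lam .two) (mu .two) k n (t - τ)) ∧
      ℙ.real {ω | N t ω = (n, .two)} =
        (1 - p) * mm1Prob (lam .two) (mu .two) j n t +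
          p * eta .one * ∑' k : ℕ, ∫ τ in (0 : ℝ)..t, Real.exp (-eta .one * τ) *
            mm1Prob (lam .one) (mu .one) j k τ * mm1Prob (lam .two) (mu .two) k n (t - τ)) ∧
    -- `mm1Prob` is the transition function of the `M/M/1` queue; its Bessel series converges
    (∀ i : Env,
      (∀ (j n : ℕ) (t : ℝ≥0), Summable (fun l : ℕ =>
        (mu i / lam i) ^ (((n + j + 2 + l : ℕ) : ℝ) / 2) *
          besselI ((n + j + 2 + l : ℕ) : ℤ) (2 * t * √(lam i * mu i)))) ∧
      ∀ P : ℝ≥0 → ℕ → ℕ → ℝ, IsTransitionFunction P →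
        HasQMatrix P (qMatrix (mm1Rate (lam i) (mu i))) →
        ∀ (t : ℝ≥0) (j n : ℕ), P t j n = mm1Prob (lam i) (mu i) j n t) ∧
    -- the alternative form of `mm1Prob` from the state 0, at positive times
    (∀ (i : Env) (n : ℕ) (t : ℝ), 0 < t →
      Summable (fun l : ℕ => ((n + 1 + l : ℕ) : ℝ) *
        (mu i / lam i) ^ (((n + 1 + l : ℕ) : ℝ) / 2) *
          besselI ((n + 1 + l : ℕ) : ℤ) (2 * t * √(lam i * mu i))) ∧
      mm1Prob (lam i) (mu i) 0 n t =
        1 / mu i * (lam i / mu i) ^ n * (1 / t) * Real.exp (-(lam i + mu i) * t) *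
          ∑' l : ℕ, ((n + 1 + l : ℕ) : ℝ) * (mu i / lam i) ^ (((n + 1 + l : ℕ) : ℝ) / 2) *
            besselI ((n + 1 + l : ℕ) : ℤ) (2 * t * √(lam i * mu i))) := by
  have heta_one : 0 < eta .one := by rwa [heta_two, add_zero] at heta_pos
  obtain ⟨P, hNP, hQ⟩ := hN
  have hP := hNP.transition
  have hlaw := hNP.real_eq_of_two_initial_states (a := (j, .one)) (b := (j, .two)) (by simp)
    hN_one hN_two
  refine ⟨fun t n => ?_, fun t n => ⟨fun k => ?_, ?_, ?_⟩, fun i => ⟨fun j n t => ?_, ?_⟩,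
    fun i n t ht => ?_⟩
  · rw [hlaw, two_one_eq_zero hlam hmu heta_two hP hQ,
      one_one_eq_exp_mul_mm1Prob hlam hmu heta_two hP hQ heta_one.le]
    ring
  · exact (((by fun_prop : Continuous fun s : ℝ => Real.exp (-eta .one * s)).mul
      (continuous_mm1Prob (hlam _) (hmu _) j k)).mul
      ((continuous_mm1Prob (hlam _) (hmu _) k n).comp
        (by fun_prop : Continuous fun s : ℝ => (t : ℝ) - s))).intervalIntegrable _ _
  · exact (hasSum_integral_one_two hlam hmu heta heta_two hP hQ heta_one t j n).summable
  · rw [hlaw, (hasSum_integral_one_two hlam hmu heta heta_two hP hQ heta_one t j n).tsum_eq,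
      two_two_eq_mm1Prob hlam hmu heta_two hP hQ]
    field_simp
    ring
  · simp only [rpow_mul_besselI_natCast (hlam i) (hmu i)]
    refine (summable_expLaurent_neg_add (hlam i).le (hmu i).le ((n + j + 2 : ℕ) : ℤ) t).congr ?_
    intro l
    rw [Nat.cast_add (n + j + 2) l]
  · exact fun P hP hQ t j n => hP.eq_mm1Prob (hlam i) (hmu i) hQ t j n
  · have h1 := hasSum_mul_expLaurent (hlam i).le (hmu i).le n t
    have h2 := mm1Prob_zero_left (hlam i) (hmu i) n t
    have h3 : ∀ r : ℕ, (r : ℝ) * (mu i / lam i) ^ ((r : ℝ) / 2) *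
        besselI (r : ℤ) (2 * t * √(lam i * mu i)) =
        r * expLaurent (lam i) (mu i) (-(r : ℤ)) t := fun r => by
      rw [mul_assoc, rpow_mul_besselI_natCast (hlam i) (hmu i)]
    simp only [h3]
    refine ⟨h1.summable, ?_⟩
    rw [h1.tsum_eq]
    have := (hmu i).ne'
    have := ht.ne'
    rw [← mul_right_inj' (mul_ne_zero (hmu i).ne' ht.ne'), h2]
    field_simp
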